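/- Let $d\ge 1$ and let $\mathfrak G$ be the set of all subsets $G\subset\mathbb R^d$ with $\operatorname{diam}(G)<1$. Let $\mathcal F$ be a $\sigma$-algebra on $\mathfrak G$ that contains the events $\{G: G\cap D\neq\emptyset\}$ and $\{G: D\subset G\}$ for every open ball $D$, and that is stable under translations $\mathcal D\mapsto x+\mathcal D=\{x+G: G\in\mathcal D\}$, $x\in\mathbb R^d$, and under those dilations $\mathcal D\mapsto\mathcal D_s=\{sG: G\in\mathcal D\}$, $s>0$, for which all sets in $\mathcal D_s$ have diameter $<1$. Let $\mu$ be a measure on $(\mathfrak G,\mathcal F)$ that is translation invariant, i.e. $\mu(x+\mathcal D)=\mu(\mathcal D)$ for all $x\in\mathbb R^d$ and $\mathcal D\in\mathcal F$, and semi scale invariant, i.e. $\mu(\mathcal D_s)=\mu(\mathcal D)$ whenever $s>0$, $\mathcal D\in\mathcal F$, $\mu(\mathcal D)<\infty$ and $\mathcal D_s$ contains only sets of diameter $<1$. Assume, with $\mathcal L$ denoting Lebesgue measure, that 1. $\mu(G: G\cap A\ne\emptyset,\ \operatorname{diam}(G)\ge\delta)<\infty$ for every bounded $A\subset\mathbb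 R^d$ and every $\delta>0$; 2. $\mu(G:\mathcal L(\partial G)>0)=0$; 3. $\mu(G:\mathcal L(G)>0)>0$. For every $\lambda>0$ let $\Phi_\lambda$ be a Poisson process on $\mathfrak G$ with intensity measure $\lambda\mu$ (a random countable collection of sets), let $\mathcal C(\lambda)=\mathbb R^d\setminus\bigcup_{G\in\Phi_\lambda}G$, and let $$\lambda_e=\inf\{\lambda>0:\ \mathcal C(\lambda)=\emptyset\ \text{almost surely}\}$$ be the critical intensity for covering $\mathbb R^d$. Let $\mathcal A_1=\{G\in\mathfrak G: 0\in G,\ 1/2\le\operatorname{diam}(G)<1\}$. Then $0<\mu(\mathcal A_1)<\infty$ and $$\lambda_e=\frac{d\log 2}{\mu(\mathcal A_1)}.$$ -/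

import Mathlib

open MeasureTheory ProbabilityTheory
open scoped ENNReal NNReal Pointwise

noncomputable section

namespace PoissonFractal

/-- The space `ℝ^d` with its Euclidean norm and Lebesgue measure `volume`. -/
abbrev E (d : ℕ) : Type := EuclideanSpace ℝ (Fin d)

/-- The space of all subsets of `ℝ^d` of diameter strictly smaller than one. It is a structure, and
not a subtype, so that it carries no `σ`-algebra by default. -/
@[ext]
structure Shape (d : ℕ) where
  carrier : Set (E d)
  ediam_lt_one : Metric.ediam carrier < 1

variable {d : ℕ}

/-- The family `x + D` of all translates `x + G` of sets `G ∈ D`. -/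
def translateFamily (x : E d) (D : Set (Shape d)) : Set (Shape d) :=
  {L | ∃ G ∈ D, L.carrier = x +ᵥ G.carrier}

/-- All sets in the rescaled family `{s • G : G ∈ D}` have diameter strictly smaller than one. -/
def ScalableBy (s : ℝ) (D : Set (Shape d)) : Prop :=
  ∀ G ∈ D, Metric.ediam (s • G.carrier) < 1

/-- The rescaled family `D_s = {L : L / s ∈ D}`; it is used only for `s > 0` with
`ScalableBy s D`, where every dilate `s • G` of a `G ∈ D` is again in the space of shapes. -/
def scaleFamily (s : ℝ) (D : Set (Shape d)) : Set (Shape d) :=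
  {L | ∃ G ∈ D, L.carrier = s • G.carrier}

/-- The suitable `σ`-algebras on the space of shapes: the events that a random shape hits a given
open ball, or contains a given open ball, are measurable, and translates and (admissible)
rescalings of measurable families are measurable. -/
structure IsSuitable (d : ℕ) [MeasurableSpace (Shape d)] : Prop where
  measurableSet_hit : ∀ (x : E d) (r : ℝ),
    MeasurableSet {G : Shape d | (G.carrier ∩ Metric.ball x r).Nonempty}
  measurableSet_contain : ∀ (x : E d) (r : ℝ),
    MeasurableSet {G : Shape d | Metric.ball x r ⊆ G.carrier}
  measurableSet_translate : ∀ (x : E d) (D : Set (Shape d)),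
    MeasurableSet D → MeasurableSet (translateFamily x D)
  measurableSet_scale : ∀ (s : ℝ) (D : Set (Shape d)), 0 < s →
    MeasurableSet D → ScalableBy s D → MeasurableSet (scaleFamily s D)

section Measures

variable [MeasurableSpace (Shape d)]

def TranslationInvariant (μ : Measure (Shape d)) : Prop :=
  ∀ (x : E d) (D : Set (Shape d)), MeasurableSet D → μ (translateFamily x D) = μ D

def SemiScaleInvariant (μ : Measure (Shape d)) : Prop :=
  ∀ (s : ℝ) (D : Set (Shape d)), 0 < s → MeasurableSet D → μ D < ∞ → ScalableBy s D →
    μ (scaleFamily s D) = μ D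

/-- Only a finite mass of sets of diameter at least `δ > 0` hits a given bounded set. -/
def LocallyFinite (μ : Measure (Shape d)) : Prop :=
  ∀ (A : Set (E d)) (δ : ℝ), Bornology.IsBounded A → 0 < δ →
    μ {G | (G.carrier ∩ A).Nonempty ∧ ENNReal.ofReal δ ≤ Metric.ediam G.carrier} < ∞

/-- Almost every set has a boundary of Lebesgue measure zero. -/
def NullBoundaries (μ : Measure (Shape d)) : Prop :=
  μ {G | 0 < volume (frontier G.carrier)} = 0

/-- The sets of positive Lebesgue measure have positive mass. -/
def PositiveVolumes (μ : Measure (Shape d)) : Prop :=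
  0 < μ {G | 0 < volume G.carrier}

end Measures

/-- The family `A₁` of the sets that contain the origin and have diameter in `[1/2, 1)`. -/
def A₁ (d : ℕ) : Set (Shape d) :=
  {G | (0 : E d) ∈ G.carrier ∧ 2⁻¹ ≤ Metric.ediam G.carrier ∧ Metric.ediam G.carrier < 1}

/-- A point process on `X` over `Ω`: a random countable collection of points of `X` (with
multiplicities), listed as `point i ω` for the indices `i < count ω`, where the number
`count ω` of points may be infinite. -/
structure PointProcess (Ω X : Type*) [MeasurableSpace Ω] [MeasurableSpace X] where
  count : Ω → ℕ∞
  point : ℕ → Ω → X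
  measurable_count : Measurable count
  measurable_point : ∀ i, Measurable (point i)

namespace PointProcess

variable {Ω X : Type*} [MeasurableSpace Ω] [MeasurableSpace X]

/-- The set of points of the process. -/
def points (Φ : PointProcess Ω X) (ω : Ω) : Set X :=
  {x | ∃ i : ℕ, (i : ℕ∞) < Φ.count ω ∧ Φ.point i ω = x}

/-- The number of points of the process in `B`, counted with multiplicity. -/
def countIn (Φ : PointProcess Ω X) (B : Set X) (ω : Ω) : ℕ∞ :=
  {i : ℕ | (i : ℕ∞) < Φ.count ω ∧ Φ.point i ω ∈ B}.encard

/-- `Φ` is a Poisson process with intensity measure `ν` under the probability measure `P`: the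
number of points in a measurable set `B` is Poisson distributed with mean `ν B` (almost surely
infinite if `ν B = ∞`), and the numbers of points in pairwise disjoint measurable sets are
independent. -/
structure IsPoisson (Φ : PointProcess Ω X) (ν : Measure X) (P : Measure Ω) : Prop where
  law_of_ne_top : ∀ B : Set X, MeasurableSet B → ν B ≠ ∞ →
    P.map (Φ.countIn B) = (poissonMeasure (ν B).toNNReal).map (Nat.cast : ℕ → ℕ∞)
  ae_eq_top : ∀ B : Set X, MeasurableSet B → ν B = ∞ → ∀ᵐ ω ∂P, Φ.countIn B ω = ⊤
  indep : ∀ (n : ℕ) (B : Fin n → Set X), (∀ i, MeasurableSet (B i)) →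
    Pairwise (fun i j => Disjoint (B i) (B j)) → iIndepFun (fun i => Φ.countIn (B i)) P

end PointProcess

/-- The random fractal `C(Φ)`: the part of `ℝ^d` that no set of the process `Φ` covers. -/
def vacantSet {Ω : Type*} [MeasurableSpace Ω] [MeasurableSpace (Shape d)]
    (Φ : PointProcess Ω (Shape d)) (ω : Ω) : Set (E d) :=
  (⋃ G ∈ Φ.points ω, G.carrier)ᶜ

/-- The critical point `λ_e = inf {λ > 0 : P(C(λ) = ∅) = 1}` of a family of point processes on the
space of shapes that is indexed by an intensity `λ`. The infimum is taken in `[0, ∞]`. -/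
def criticalIntensity {Ω : ℝ≥0 → Type*} [∀ l, MeasurableSpace (Ω l)] [MeasurableSpace (Shape d)]
    (P : ∀ l, Measure (Ω l)) (Φ : ∀ l, PointProcess (Ω l) (Shape d)) : ℝ≥0∞ :=
  ⨅ l ∈ {l : ℝ≥0 | 0 < l ∧ ∀ᵐ ω ∂(P l), vacantSet (Φ l) ω = ∅}, (l : ℝ≥0∞)

end PoissonFractal

end

/-!
The shapes of positive diameter are sorted into the dyadic bands
`band d k = {G : 2 ^ (-(k + 1)) ≤ diam G < 2 ^ (-k)}`. Translation and semi scale invariance give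
the same mass to "band `k` hits (contains) the ball of radius `2 ^ (-k) * r` around `x`" for all `k`
and `x` (`measure_hitBand`, `measure_containBand`). Let `a = μ (A₁ d)`. By Tonelli's theorem and
translation invariance, the shapes of band `0` with the origin on their boundary form a null set, so
as `r → 0` the mass of the shapes of band `0` that hit the ball of radius `r` around the origin
decreases to `a`, and that of the shapes containing this ball increases to `a`
(`exists_measure_hitBand_lt`, `exists_lt_measure_containBand`). This also takes care of the fact
that `A₁ d` itself need not be measurable. Only the avoidance probabilities
`P (no point in B) = exp (-ν B)` of the Poisson processes are used.

*Covering for `λ a > d log 2`* (`ae_vacantSet_eq_empty`). With `a'` slightly smaller than `a`, a ball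
of radius of order `2 ^ (-n)` is not contained in a single shape of the first `n` bands with
probability at most `exp (-λ a' n)`. A bounded set is covered by order `2 ^ (d n)` such balls, so
the expected number of bad balls tends to zero.

*Vacancy for `λ a < d log 2`* (`not_ae_vacantSet_eq_empty`). Fix a small `r`, and let `K n` be the
set of points of a compact ball at distance at least `2 ^ (-k) * r` from all shapes of band `k`, for
all `k < n`. These sets are compact and decreasing, and no shape of positive diameter meets their
intersection. With `q = exp (λ a')`, for `a'` slightly larger than `a`, a grid point lies in `K n`
with probability `q ^ (-n)`, and two points at distance about `2 ^ (-j)` both do with probability of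
order `q ^ (-2 n) * q ^ j`. As `q < 2 ^ d`, the expected energy of the normalized counting measure
on the points of the grid `2 ^ (-n) ℤ ^ d ∩ [0, 1) ^ d` in `K n` is bounded, even for a kernel that
is singular on the diagonal. A truncated second moment argument (`le_measureReal_spreadEvent`) then
shows that with positive probability, for infinitely many `n`, these measures have mass at least
`1 / 2` and bounded energy. In that case the intersection of the `K n` is uncountable
(`not_countable_iInter`). Uncountability, and not just non-emptiness, is needed because the
hypotheses do not bound the mass of the shapes of diameter zero; these may be dense, and may depend
on the other shapes if their mass is infinite, but they cover only countably many points.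
-/

namespace PoissonFractal

open Filter Topology

variable {d : ℕ}

/-! ### Measurable families of shapes -/

/-- A countable family of open balls that forms a basis of the topology of `ℝ^d`. -/
def basicBall (d : ℕ) (p : ℕ × ℕ) : Set (E d) :=
  Metric.ball (TopologicalSpace.denseSeq (E d) p.1) (1 / ((p.2 : ℝ) + 1))

lemma isOpen_basicBall (p : ℕ × ℕ) : IsOpen (basicBall d p) := Metric.isOpen_ball

lemma exists_basicBall_subset {x : E d} {U : Set (E d)} (hU : U ∈ 𝓝 x) :
    ∃ p, x ∈ basicBall d p ∧ basicBall d p ⊆ U := by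
  obtain ⟨ε, hε, hsub⟩ := Metric.mem_nhds_iff.1 hU
  obtain ⟨n, hn⟩ := exists_nat_one_div_lt (half_pos hε)
  obtain ⟨m, hm⟩ := (TopologicalSpace.denseRange_denseSeq (E d)).exists_dist_lt x
    (ε := 1 / ((n : ℝ) + 1)) (by positivity)
  refine ⟨(m, n), hm, fun y hy => hsub ?_⟩
  have hy' : dist y (TopologicalSpace.denseSeq (E d) m) < 1 / ((n : ℝ) + 1) := hy
  rw [Metric.mem_ball]
  rw [dist_comm] at hm
  linarith [dist_triangle y (TopologicalSpace.denseSeq (E d) m) x]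

section Measurability

variable [MeasurableSpace (Shape d)]

lemma IsSuitable.measurable_ediam (hF : IsSuitable d) :
    Measurable fun G : Shape d => Metric.ediam G.carrier := by
  refine measurable_of_Ioi fun t => ?_
  have key : (fun G : Shape d => Metric.ediam G.carrier) ⁻¹' Set.Ioi t =
      ⋃ pq ∈ {pq : (ℕ × ℕ) × (ℕ × ℕ) | basicBall d pq.1 ×ˢ basicBall d pq.2 ⊆
        {z : E d × E d | t < edist z.1 z.2}},
        ({G : Shape d | (G.carrier ∩ basicBall d pq.1).Nonempty} ∩
          {G : Shape d | (G.carrier ∩ basicBall d pq.2).Nonempty}) := by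
    ext G
    simp only [Set.mem_preimage, Set.mem_Ioi, Set.mem_iUnion, Set.mem_inter_iff,
      Set.mem_ofPred_eq, exists_prop]
    constructor
    · intro h
      have : ∃ x ∈ G.carrier, ∃ y ∈ G.carrier, t < edist x y := by
        by_contra! hcon
        exact absurd (Metric.ediam_le hcon) (not_le.2 h)
      obtain ⟨x, hx, y, hy, hxy⟩ := this
      have hO : IsOpen {z : E d × E d | t < edist z.1 z.2} :=
        isOpen_lt continuous_const (continuous_fst.edist continuous_snd)
      obtain ⟨U, hU, V, hV, hUV⟩ := mem_nhds_prod_iff.1 (hO.mem_nhds (show (x, y) ∈ _ from hxy))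
      obtain ⟨p, hp, hpU⟩ := exists_basicBall_subset hU
      obtain ⟨q, hq, hqV⟩ := exists_basicBall_subset hV
      have hsub : basicBall d p ×ˢ basicBall d q ⊆ {z : E d × E d | t < edist z.1 z.2} :=
        (Set.prod_mono hpU hqV).trans hUV
      refine ⟨(p, q), hsub, ?_, ?_⟩
      · exact ⟨x, hx, hp⟩
      · exact ⟨y, hy, hq⟩
    · rintro ⟨⟨p, q⟩, hsub, ⟨x, hx, hxp⟩, ⟨y, hy, hyq⟩⟩
      have hz : (x, y) ∈ {z : E d × E d | t < edist z.1 z.2} := hsub (Set.mk_mem_prod hxp hyq)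
      rw [Set.mem_ofPred_eq] at hz
      exact hz.trans_le (Metric.edist_le_ediam_of_mem hx hy)
  rw [key]
  exact MeasurableSet.biUnion (Set.to_countable _) fun pq _ =>
    (hF.measurableSet_hit _ _).inter (hF.measurableSet_hit _ _)

lemma IsSuitable.measurableSet_mem_closure (hF : IsSuitable d) :
    MeasurableSet {z : E d × Shape d | z.1 ∈ closure z.2.carrier} := by
  have key : {z : E d × Shape d | z.1 ∈ closure z.2.carrier}ᶜ =
      ⋃ p : ℕ × ℕ, basicBall d p ×ˢ {G : Shape d | (G.carrier ∩ basicBall d p).Nonempty}ᶜ := by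
    ext ⟨x, G⟩
    simp only [Set.mem_compl_iff, Set.mem_ofPred_eq, Set.mem_iUnion, Set.mem_prod]
    constructor
    · intro h
      obtain ⟨p, hp, hsub⟩ := exists_basicBall_subset (isClosed_closure.isOpen_compl.mem_nhds h)
      exact ⟨p, hp, fun ⟨y, hy, hyp⟩ => hsub hyp (subset_closure hy)⟩
    · rintro ⟨p, hp, hG⟩ h
      obtain ⟨y, hyp, hy⟩ := mem_closure_iff.1 h _ (isOpen_basicBall p) hp
      exact hG ⟨y, hy, hyp⟩
  rw [← MeasurableSet.compl_iff, key]
  exact MeasurableSet.iUnion fun p => (isOpen_basicBall p).measurableSet.prod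
    (hF.measurableSet_hit _ _).compl

lemma IsSuitable.measurableSet_mem_interior (hF : IsSuitable d) :
    MeasurableSet {z : E d × Shape d | z.1 ∈ interior z.2.carrier} := by
  have key : {z : E d × Shape d | z.1 ∈ interior z.2.carrier} =
      ⋃ p : ℕ × ℕ, basicBall d p ×ˢ {G : Shape d | basicBall d p ⊆ G.carrier} := by
    ext ⟨x, G⟩
    simp only [Set.mem_ofPred_eq, Set.mem_iUnion, Set.mem_prod]
    constructor
    · intro h
      exact exists_basicBall_subset (mem_interior_iff_mem_nhds.1 h)
    · rintro ⟨p, hp, hG⟩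
      exact interior_maximal hG (isOpen_basicBall p) hp
  rw [key]
  exact MeasurableSet.iUnion fun p => (isOpen_basicBall p).measurableSet.prod
    (hF.measurableSet_contain _ _)

lemma IsSuitable.measurableSet_mem_frontier (hF : IsSuitable d) :
    MeasurableSet {z : E d × Shape d | z.1 ∈ frontier z.2.carrier} :=
  hF.measurableSet_mem_closure.diff hF.measurableSet_mem_interior

end Measurability

/-! ### Dyadic diameter bands -/

/-- The shapes whose diameter lies in the dyadic band `[2^{-(k+1)}, 2^{-k})`. -/
def band (d k : ℕ) : Set (Shape d) :=
  {G | (2⁻¹ : ℝ≥0∞) ^ (k + 1) ≤ Metric.ediam G.carrier ∧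
    Metric.ediam G.carrier < (2⁻¹ : ℝ≥0∞) ^ k}

lemma exists_mem_band {G : Shape d} (h : 0 < Metric.ediam G.carrier) : ∃ k, G ∈ band d k := by
  have hlim : ∃ n, (2⁻¹ : ℝ≥0∞) ^ n ≤ Metric.ediam G.carrier := by
    obtain ⟨n, hn⟩ := ENNReal.exists_inv_two_pow_lt h.ne'
    exact ⟨n, hn.le⟩
  classical
  have h0 : Nat.find hlim ≠ 0 := by
    intro h0
    have := Nat.find_spec hlim
    rw [h0, pow_zero] at this
    exact absurd G.ediam_lt_one (not_lt.2 this)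
  obtain ⟨k, hk⟩ := Nat.exists_eq_succ_of_ne_zero h0
  refine ⟨k, ?_, ?_⟩
  · have := Nat.find_spec hlim
    rwa [hk] at this
  · exact not_le.1 (Nat.find_min hlim (by omega))

/-- The shapes in band `k` that hit the open ball of radius `r` around `x`. -/
def hitBand (k : ℕ) (x : E d) (r : ℝ) : Set (Shape d) :=
  {G | (G.carrier ∩ Metric.ball x r).Nonempty} ∩ band d k

/-- The shapes in band `k` that contain the open ball of radius `r` around `x`. -/
def containBand (k : ℕ) (x : E d) (r : ℝ) : Set (Shape d) :=
  {G | Metric.ball x r ⊆ G.carrier} ∩ band d k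

/-- The shapes in band `k` whose closure contains `x`. -/
def closureBand (k : ℕ) (x : E d) : Set (Shape d) :=
  {G | x ∈ closure G.carrier} ∩ band d k

section Measurability

variable [MeasurableSpace (Shape d)]

lemma IsSuitable.measurableSet_band (hF : IsSuitable d) (k : ℕ) : MeasurableSet (band d k) :=
  (measurableSet_le measurable_const hF.measurable_ediam).inter
    (measurableSet_lt hF.measurable_ediam measurable_const)

lemma IsSuitable.measurableSet_hitBand (hF : IsSuitable d) (k : ℕ) (x : E d) (r : ℝ) :
    MeasurableSet (hitBand k x r) :=
  (hF.measurableSet_hit x r).inter (hF.measurableSet_band k)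

lemma IsSuitable.measurableSet_containBand (hF : IsSuitable d) (k : ℕ) (x : E d) (r : ℝ) :
    MeasurableSet (containBand k x r) :=
  (hF.measurableSet_contain x r).inter (hF.measurableSet_band k)

lemma IsSuitable.measurableSet_closureBand (hF : IsSuitable d) (k : ℕ) (x : E d) :
    MeasurableSet (closureBand k x) :=
  (measurable_prodMk_left hF.measurableSet_mem_closure).inter (hF.measurableSet_band k)

end Measurability

/-! ### Translating and rescaling families -/

lemma translateFamily_setOf (x : E d) (p : Set (E d) → Prop) :
    translateFamily x {G : Shape d | p G.carrier} = {L | p (-x +ᵥ L.carrier)} := by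
  ext L
  constructor
  · rintro ⟨G, hG, hL⟩
    simpa [hL] using hG
  · intro hL
    refine ⟨⟨-x +ᵥ L.carrier, ?_⟩, hL, by simp⟩
    rw [ediam_vadd]
    exact L.ediam_lt_one

lemma ediam_two_pow_smul (k : ℕ) (s : Set (E d)) :
    Metric.ediam ((2⁻¹ : ℝ) ^ k • s) = (2⁻¹ : ℝ≥0∞) ^ k * Metric.ediam s := by
  rw [ediam_smul₀, ENNReal.smul_def, smul_eq_mul]
  congr 1
  rw [nnnorm_pow, ENNReal.coe_pow, nnnorm_inv]
  simp

lemma scaleFamily_setOf (k : ℕ) (p : Set (E d) → Prop) :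
    scaleFamily ((2⁻¹ : ℝ) ^ k) {G : Shape d | p ((2⁻¹ : ℝ) ^ k • G.carrier)} =
      {L | p L.carrier ∧ Metric.ediam L.carrier < (2⁻¹ : ℝ≥0∞) ^ k} := by
  have h0 : (2⁻¹ : ℝ) ^ k ≠ 0 := by positivity
  have hE0 : (2⁻¹ : ℝ≥0∞) ^ k ≠ 0 := pow_ne_zero _ (by simp)
  have hEt : (2⁻¹ : ℝ≥0∞) ^ k ≠ ∞ := ENNReal.pow_ne_top (by simp)
  ext L
  constructor
  · rintro ⟨G, hG, hL⟩
    refine ⟨by simpa [hL] using hG, ?_⟩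
    rw [hL, ediam_two_pow_smul]
    simpa using ENNReal.mul_lt_mul_right hE0 hEt G.ediam_lt_one
  · rintro ⟨hL, hdiam⟩
    have hback : (2⁻¹ : ℝ) ^ k • (((2⁻¹ : ℝ) ^ k)⁻¹ • L.carrier) = L.carrier :=
      smul_inv_smul₀ h0 _
    refine ⟨⟨((2⁻¹ : ℝ) ^ k)⁻¹ • L.carrier, ?_⟩, ?_, hback.symm⟩
    · rw [← hback, ediam_two_pow_smul] at hdiam
      by_contra! hcon
      have := mul_le_mul_right hcon ((2⁻¹ : ℝ≥0∞) ^ k)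
      rw [mul_one] at this
      exact absurd hdiam (not_lt.2 this)
    · change p _
      rwa [hback]

lemma scalableBy_two_pow (k : ℕ) (D : Set (Shape d)) : ScalableBy ((2⁻¹ : ℝ) ^ k) D := by
  intro G _
  rw [ediam_two_pow_smul]
  exact (mul_le_of_le_one_left' (pow_le_one' (by simp) k)).trans_lt G.ediam_lt_one

lemma smul_two_pow_mem_band (k : ℕ) (s : Set (E d)) :
    ((2⁻¹ : ℝ≥0∞) ^ (k + 1) ≤ Metric.ediam ((2⁻¹ : ℝ) ^ k • s) ∧
      Metric.ediam ((2⁻¹ : ℝ) ^ k • s) < (2⁻¹ : ℝ≥0∞) ^ k) ↔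
    ((2⁻¹ : ℝ≥0∞) ^ (0 + 1) ≤ Metric.ediam s ∧ Metric.ediam s < (2⁻¹ : ℝ≥0∞) ^ 0) := by
  have hE0 : (2⁻¹ : ℝ≥0∞) ^ k ≠ 0 := pow_ne_zero _ (by simp)
  have hEt : (2⁻¹ : ℝ≥0∞) ^ k ≠ ∞ := ENNReal.pow_ne_top (by simp)
  rw [ediam_two_pow_smul, pow_succ, ENNReal.mul_le_mul_iff_right hE0 hEt]
  nth_rw 2 [← mul_one ((2⁻¹ : ℝ≥0∞) ^ k)]
  rw [ENNReal.mul_lt_mul_iff_right hE0 hEt]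
  simp

lemma containBand_subset_hitBand {k : ℕ} {x : E d} {r : ℝ} (hr : 0 < r) :
    containBand k x r ⊆ hitBand k x r := fun _ hG =>
  ⟨⟨x, hG.1 (Metric.mem_ball_self hr), Metric.mem_ball_self hr⟩, hG.2⟩

lemma closureBand_subset_hitBand {k : ℕ} {x : E d} {r : ℝ} (hr : 0 < r) :
    closureBand k x ⊆ hitBand k x r := by
  rintro G ⟨hG, hb⟩
  obtain ⟨y, hy, hyG⟩ := mem_closure_iff.1 hG _ Metric.isOpen_ball (Metric.mem_ball_self hr)
  exact ⟨⟨y, hyG, hy⟩, hb⟩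

lemma two_pow_smul_ball (k : ℕ) (r : ℝ) :
    (2⁻¹ : ℝ) ^ k • Metric.ball (0 : E d) r = Metric.ball 0 ((2⁻¹ : ℝ) ^ k * r) := by
  rw [smul_ball (by positivity), smul_zero, Real.norm_of_nonneg (by positivity)]

section Invariance

variable [MeasurableSpace (Shape d)] {μ : Measure (Shape d)}

/-- Semi scale invariance and translation invariance transport a family in band `0` to band `k`
around any centre. -/
lemma measure_inter_band_eq (htrans : TranslationInvariant μ) (hscale : SemiScaleInvariant μ)
    (k : ℕ) (x : E d) (p : Set (E d) → Prop)
    (hm : MeasurableSet {G : Shape d | p G.carrier ∧ G ∈ band d k})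
    (hm0 : MeasurableSet {G : Shape d | p ((2⁻¹ : ℝ) ^ k • G.carrier) ∧ G ∈ band d 0})
    (hfin : μ {G : Shape d | p ((2⁻¹ : ℝ) ^ k • G.carrier) ∧ G ∈ band d 0} < ∞) :
    μ {G : Shape d | p (-x +ᵥ G.carrier) ∧ G ∈ band d k} =
      μ {G : Shape d | p ((2⁻¹ : ℝ) ^ k • G.carrier) ∧ G ∈ band d 0} := by
  have h1 := hscale ((2⁻¹ : ℝ) ^ k) _ (by positivity) hm0 hfin (scalableBy_two_pow k _)
  rw [← h1]
  have h2 := htrans x _ hm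
  have e1 : translateFamily x {G : Shape d | p G.carrier ∧ G ∈ band d k} =
      {G : Shape d | p (-x +ᵥ G.carrier) ∧ G ∈ band d k} := by
    have := translateFamily_setOf x (fun s => p s ∧ ((2⁻¹ : ℝ≥0∞) ^ (k + 1) ≤ Metric.ediam s ∧
      Metric.ediam s < (2⁻¹ : ℝ≥0∞) ^ k))
    simp only [ediam_vadd] at this
    exact this
  have e2 : scaleFamily ((2⁻¹ : ℝ) ^ k)
      {G : Shape d | p ((2⁻¹ : ℝ) ^ k • G.carrier) ∧ G ∈ band d 0} =
      {G : Shape d | p G.carrier ∧ G ∈ band d k} := by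
    have := scaleFamily_setOf k (fun s : Set (E d) => p s ∧ ((2⁻¹ : ℝ≥0∞) ^ (k + 1) ≤
      Metric.ediam s ∧ Metric.ediam s < (2⁻¹ : ℝ≥0∞) ^ k))
    simp only [smul_two_pow_mem_band] at this
    refine Eq.trans this ?_
    ext G
    exact ⟨fun h => h.1, fun h => ⟨h, h.2.2⟩⟩
  rw [e2, ← h2, e1]

lemma LocallyFinite.measure_hitBand_lt_top (hfin : LocallyFinite μ) (k : ℕ) (x : E d) (r : ℝ) :
    μ (hitBand k x r) < ∞ := by
  refine (measure_mono ?_).trans_lt (hfin (Metric.ball x r) ((2⁻¹ : ℝ) ^ (k + 1))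
    Metric.isBounded_ball (by positivity))
  rintro G ⟨hG, hG1, -⟩
  refine ⟨hG, le_trans (le_of_eq ?_) hG1⟩
  rw [ENNReal.ofReal_pow (by norm_num), ENNReal.ofReal_inv_of_pos (by norm_num)]
  simp

lemma measure_hitBand (hF : IsSuitable d) (htrans : TranslationInvariant μ)
    (hscale : SemiScaleInvariant μ) (hfin : LocallyFinite μ) (k : ℕ) (x : E d) (r : ℝ) :
    μ (hitBand k x ((2⁻¹ : ℝ) ^ k * r)) = μ (hitBand 0 (0 : E d) r) := by
  have h0 : (2⁻¹ : ℝ) ^ k ≠ 0 := by positivity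
  have e0 : {G : Shape d | ((2⁻¹ : ℝ) ^ k • G.carrier ∩
      Metric.ball (0 : E d) ((2⁻¹ : ℝ) ^ k * r)).Nonempty ∧ G ∈ band d 0} =
      hitBand 0 (0 : E d) r := by
    ext G
    simp only [hitBand, ← two_pow_smul_ball, ← Set.smul_set_inter₀ h0, Set.smul_set_nonempty]
    rfl
  have e1 : {G : Shape d | ((-x +ᵥ G.carrier) ∩
      Metric.ball (0 : E d) ((2⁻¹ : ℝ) ^ k * r)).Nonempty ∧ G ∈ band d k} =
      hitBand k x ((2⁻¹ : ℝ) ^ k * r) := by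
    ext G
    have : Metric.ball (0 : E d) ((2⁻¹ : ℝ) ^ k * r) =
        -x +ᵥ Metric.ball x ((2⁻¹ : ℝ) ^ k * r) := by simp [Metric.vadd_ball]
    simp only [hitBand, this, ← Set.vadd_set_inter, Set.vadd_set_nonempty]
    rfl
  rw [← e0, ← e1]
  refine measure_inter_band_eq htrans hscale k x
    (fun s => (s ∩ Metric.ball (0 : E d) ((2⁻¹ : ℝ) ^ k * r)).Nonempty)
    (hF.measurableSet_hitBand k 0 _) ?_ ?_
  · rw [e0]; exact hF.measurableSet_hitBand 0 0 _
  · rw [e0]; exact hfin.measure_hitBand_lt_top 0 0 r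

lemma measure_containBand (hF : IsSuitable d) (htrans : TranslationInvariant μ)
    (hscale : SemiScaleInvariant μ) (hfin : LocallyFinite μ) (k : ℕ) (x : E d) {r : ℝ}
    (hr : 0 < r) :
    μ (containBand k x ((2⁻¹ : ℝ) ^ k * r)) = μ (containBand 0 (0 : E d) r) := by
  have h0 : (2⁻¹ : ℝ) ^ k ≠ 0 := by positivity
  have e0 : {G : Shape d | Metric.ball (0 : E d) ((2⁻¹ : ℝ) ^ k * r) ⊆
      (2⁻¹ : ℝ) ^ k • G.carrier ∧ G ∈ band d 0} = containBand 0 (0 : E d) r := by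
    ext G
    simp only [containBand, ← two_pow_smul_ball, Set.smul_set_subset_smul_set_iff₀ h0]
    rfl
  have e1 : {G : Shape d | Metric.ball (0 : E d) ((2⁻¹ : ℝ) ^ k * r) ⊆
      (-x +ᵥ G.carrier) ∧ G ∈ band d k} = containBand k x ((2⁻¹ : ℝ) ^ k * r) := by
    ext G
    have : Metric.ball (0 : E d) ((2⁻¹ : ℝ) ^ k * r) =
        -x +ᵥ Metric.ball x ((2⁻¹ : ℝ) ^ k * r) := by simp [Metric.vadd_ball]
    simp only [containBand, this, Set.vadd_set_subset_vadd_set_iff]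
    rfl
  rw [← e0, ← e1]
  refine measure_inter_band_eq htrans hscale k x
    (fun s => Metric.ball (0 : E d) ((2⁻¹ : ℝ) ^ k * r) ⊆ s)
    (hF.measurableSet_containBand k 0 _) ?_ ?_
  · rw [e0]; exact hF.measurableSet_containBand 0 0 _
  · rw [e0]
    exact (measure_mono (containBand_subset_hitBand hr)).trans_lt
      (hfin.measure_hitBand_lt_top 0 0 r)

lemma measure_closureBand (hF : IsSuitable d) (htrans : TranslationInvariant μ)
    (hscale : SemiScaleInvariant μ) (hfin : LocallyFinite μ) (k : ℕ) (x : E d) :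
    μ (closureBand k x) = μ (closureBand 0 (0 : E d)) := by
  have h0 : (2⁻¹ : ℝ) ^ k ≠ 0 := by positivity
  have e0 : {G : Shape d | (0 : E d) ∈ closure ((2⁻¹ : ℝ) ^ k • G.carrier) ∧ G ∈ band d 0} =
      closureBand 0 (0 : E d) := by
    ext G
    simp only [closureBand, closure_smul₀' h0, Set.zero_mem_smul_set_iff h0]
    rfl
  have e1 : {G : Shape d | (0 : E d) ∈ closure (-x +ᵥ G.carrier) ∧ G ∈ band d k} =
      closureBand k x := by
    ext G
    simp only [closureBand, closure_vadd, Set.mem_vadd_set_iff_neg_vadd_mem]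
    simp only [neg_neg, vadd_eq_add, add_zero]
    rfl
  rw [← e0, ← e1]
  refine measure_inter_band_eq htrans hscale k x (fun s => (0 : E d) ∈ closure s)
    (hF.measurableSet_closureBand k 0) ?_ ?_
  · rw [e0]; exact hF.measurableSet_closureBand 0 0
  · rw [e0]
    exact (measure_mono (closureBand_subset_hitBand one_pos)).trans_lt
      (hfin.measure_hitBand_lt_top 0 0 1)

end Invariance

/-! ### The mass of the shapes around a point -/

/-- The shapes in band `0` with the point `x` on their boundary. -/
def frontierBand (x : E d) : Set (Shape d) :=
  {G | x ∈ frontier G.carrier} ∩ band d 0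

lemma frontier_vadd_set (x : E d) (s : Set (E d)) : frontier (x +ᵥ s) = x +ᵥ frontier s :=
  ((Homeomorph.vadd x).image_frontier s).symm

lemma A₁_subset_closureBand : A₁ d ⊆ closureBand 0 (0 : E d) := fun _ hG =>
  ⟨subset_closure hG.1, by simpa [band] using hG.2⟩

lemma interior_subset_A₁ :
    {G : Shape d | (0 : E d) ∈ interior G.carrier} ∩ band d 0 ⊆ A₁ d := fun _ hG =>
  ⟨interior_subset hG.1, by simpa [band] using hG.2⟩

section Mass

variable [MeasurableSpace (Shape d)] {μ : Measure (Shape d)}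

lemma measure_frontierBand (hF : IsSuitable d) (htrans : TranslationInvariant μ) (x : E d) :
    μ (frontierBand x) = μ (frontierBand (0 : E d)) := by
  have hm : MeasurableSet (frontierBand (0 : E d)) :=
    (measurable_prodMk_left hF.measurableSet_mem_frontier).inter (hF.measurableSet_band 0)
  rw [← htrans x _ hm]
  congr 1
  have := translateFamily_setOf x (fun s => (0 : E d) ∈ frontier s ∧
    ((2⁻¹ : ℝ≥0∞) ^ (0 + 1) ≤ Metric.ediam s ∧ Metric.ediam s < (2⁻¹ : ℝ≥0∞) ^ 0))
  simp only [ediam_vadd, frontier_vadd_set, Set.mem_vadd_set_iff_neg_vadd_mem, neg_neg,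
    vadd_eq_add, add_zero] at this
  exact this.symm

/-- By Tonelli's theorem, `x` lies on the boundary of almost no shape of band `0` for almost every
`x` near the origin, and by translation invariance one such `x` suffices. -/
lemma measure_frontierBand_zero (hF : IsSuitable d) (htrans : TranslationInvariant μ)
    (hfin : LocallyFinite μ) (hbdry : NullBoundaries μ) : μ (frontierBand (0 : E d)) = 0 := by
  have hband : μ (hitBand 0 (0 : E d) 2) < ∞ := hfin.measure_hitBand_lt_top 0 0 2
  have : IsFiniteMeasure (μ.restrict (hitBand 0 (0 : E d) 2)) :=
    ⟨by rwa [Measure.restrict_apply_univ]⟩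
  have hS := hF.measurableSet_mem_frontier
  have hprod : ((volume : Measure (E d)).prod (μ.restrict (hitBand 0 (0 : E d) 2)))
      {z : E d × Shape d | z.1 ∈ frontier z.2.carrier} = 0 := by
    rw [Measure.prod_apply_symm hS, lintegral_eq_zero_iff (measurable_measure_prodMk_right hS)]
    refine ae_restrict_of_ae (ae_iff.2 (measure_mono_null (fun G hG => ?_) hbdry))
    exact pos_iff_ne_zero.2 hG
  have hae := Measure.measure_ae_null_of_prod_null hprod
  have hpos : 0 < volume (Metric.ball (0 : E d) 1) := Metric.measure_ball_pos _ _ one_pos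
  obtain ⟨x, hx, hx0⟩ : ∃ x ∈ Metric.ball (0 : E d) 1,
      (μ.restrict (hitBand 0 (0 : E d) 2)) {G | x ∈ frontier G.carrier} = 0 := by
    by_contra! hcon
    refine hpos.ne' (measure_mono_null (fun x hx => ?_) (ae_iff.1 hae))
    exact hcon x hx
  rw [← measure_frontierBand hF htrans x]
  have hSx : MeasurableSet {G : Shape d | x ∈ frontier G.carrier} := measurable_prodMk_left hS
  rw [Measure.restrict_apply hSx] at hx0
  refine measure_mono_null ?_ hx0
  rintro G ⟨hG, hb⟩
  refine ⟨hG, ?_, hb⟩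
  obtain ⟨y, hy, hyG⟩ := mem_closure_iff.1 (frontier_subset_closure hG) _ Metric.isOpen_ball
    (Metric.mem_ball_self one_pos)
  refine ⟨y, hyG, ?_⟩
  rw [Metric.mem_ball] at hx hy ⊢
  linarith [dist_triangle y x 0]

lemma measure_closureBand_le_interior (hF : IsSuitable d) (htrans : TranslationInvariant μ)
    (hfin : LocallyFinite μ) (hbdry : NullBoundaries μ) :
    μ (closureBand 0 (0 : E d)) ≤ μ ({G : Shape d | (0 : E d) ∈ interior G.carrier} ∩ band d 0) := by
  have hsub : closureBand 0 (0 : E d) ⊆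
      ({G : Shape d | (0 : E d) ∈ interior G.carrier} ∩ band d 0) ∪ frontierBand 0 := by
    rintro G ⟨hG, hb⟩
    by_cases h : (0 : E d) ∈ interior G.carrier
    · exact Or.inl ⟨h, hb⟩
    · exact Or.inr ⟨⟨hG, h⟩, hb⟩
  refine (measure_mono hsub).trans ((measure_union_le _ _).trans ?_)
  rw [measure_frontierBand_zero hF htrans hfin hbdry, add_zero]

/-- Although `A₁` need not be measurable, its mass is that of the shapes in band `0` whose closure
contains the origin. -/
lemma measure_A₁ (hF : IsSuitable d) (htrans : TranslationInvariant μ)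
    (hfin : LocallyFinite μ) (hbdry : NullBoundaries μ) :
    μ (A₁ d) = μ (closureBand 0 (0 : E d)) :=
  le_antisymm (measure_mono A₁_subset_closureBand)
    ((measure_closureBand_le_interior hF htrans hfin hbdry).trans (measure_mono interior_subset_A₁))

lemma measure_A₁_lt_top (hfin : LocallyFinite μ) : μ (A₁ d) < ∞ :=
  (measure_mono (A₁_subset_closureBand.trans (closureBand_subset_hitBand one_pos))).trans_lt
    (hfin.measure_hitBand_lt_top 0 0 1)

/-- If `A₁` were null, then by scaling and translation the shapes of each band whose closure
contains a given point would be null, and Tonelli's theorem would make almost all shapes null. -/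
lemma measure_A₁_pos (hd : 1 ≤ d) (hF : IsSuitable d) (htrans : TranslationInvariant μ)
    (hscale : SemiScaleInvariant μ) (hfin : LocallyFinite μ) (hbdry : NullBoundaries μ)
    (hpos : PositiveVolumes μ) : 0 < μ (A₁ d) := by
  rw [measure_A₁ hF htrans hfin hbdry, pos_iff_ne_zero]
  intro h0
  have hS := hF.measurableSet_mem_closure
  have hnull : ∀ k n : ℕ, μ ({G : Shape d | 0 < volume G.carrier} ∩ hitBand k 0 n) = 0 := by
    intro k n
    have : IsFiniteMeasure (μ.restrict (hitBand k (0 : E d) n)) :=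
      ⟨by rw [Measure.restrict_apply_univ]; exact hfin.measure_hitBand_lt_top k 0 n⟩
    have hprod : ((volume : Measure (E d)).prod (μ.restrict (hitBand k (0 : E d) n)))
        {z : E d × Shape d | z.1 ∈ closure z.2.carrier} = 0 := by
      rw [Measure.measure_prod_null hS]
      refine ae_of_all _ fun x => ?_
      change (μ.restrict (hitBand k (0 : E d) n)) {G | x ∈ closure G.carrier} = 0
      have hSx : MeasurableSet {G : Shape d | x ∈ closure G.carrier} := measurable_prodMk_left hS
      rw [Measure.restrict_apply hSx]
      refine measure_mono_null ?_ ((measure_closureBand hF htrans hscale hfin k x).trans h0)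
      exact fun G hG => ⟨hG.1, hG.2.2⟩
    rw [Measure.prod_apply_symm hS, lintegral_eq_zero_iff (measurable_measure_prodMk_right hS)]
      at hprod
    have hprod' : (μ.restrict (hitBand k (0 : E d) n))
        {G | ¬ volume (closure G.carrier) = 0} = 0 := ae_iff.1 hprod
    rw [Measure.restrict_apply₀' (hF.measurableSet_hitBand k 0 n).nullMeasurableSet] at hprod'
    refine measure_mono_null ?_ hprod'
    exact fun G hG => ⟨(hG.1.trans_le (measure_mono subset_closure)).ne', hG.2⟩
  have hcov : {G : Shape d | 0 < volume G.carrier} ⊆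
      ⋃ k : ℕ, ⋃ n : ℕ, {G : Shape d | 0 < volume G.carrier} ∩ hitBand k 0 n := by
    intro G hG
    have : Nonempty (Fin d) := ⟨⟨0, hd⟩⟩
    have hdiam : 0 < Metric.ediam G.carrier := by
      rw [Metric.ediam_pos_iff]
      by_contra hcon
      exact hG.ne' ((Set.not_nontrivial_iff.1 hcon).measure_zero _)
    obtain ⟨k, hk⟩ := exists_mem_band hdiam
    obtain ⟨y, hy⟩ : G.carrier.Nonempty := nonempty_of_measure_ne_zero hG.ne'
    obtain ⟨n, hn⟩ := exists_nat_gt (dist y 0)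
    exact Set.mem_iUnion.2 ⟨k, Set.mem_iUnion.2 ⟨n, hG, ⟨y, hy, hn⟩, hk⟩⟩
  exact hpos.ne' (measure_mono_null hcov (measure_iUnion_null fun k =>
    measure_iUnion_null fun n => hnull k n))

lemma exists_measure_hitBand_lt (hF : IsSuitable d) (htrans : TranslationInvariant μ)
    (hfin : LocallyFinite μ) (hbdry : NullBoundaries μ) {t : ℝ≥0∞} (ht : μ (A₁ d) < t) :
    ∃ r : ℝ, 0 < r ∧ r ≤ 1 / 2 ∧ μ (hitBand 0 (0 : E d) r) < t := by
  have hanti : Antitone fun n : ℕ => hitBand 0 (0 : E d) ((1 / 2 : ℝ) ^ (n + 1)) := by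
    intro m n hmn G hG
    refine ⟨hG.1.mono (Set.inter_subset_inter_right _ (Metric.ball_subset_ball ?_)), hG.2⟩
    exact pow_le_pow_of_le_one (by norm_num) (by norm_num) (by omega)
  have hlim := tendsto_measure_iInter_atTop (μ := μ)
    (fun n => (hF.measurableSet_hitBand 0 (0 : E d) ((1 / 2 : ℝ) ^ (n + 1))).nullMeasurableSet)
    hanti ⟨0, (hfin.measure_hitBand_lt_top 0 0 _).ne⟩
  have hle : μ (⋂ n : ℕ, hitBand 0 (0 : E d) ((1 / 2 : ℝ) ^ (n + 1))) ≤ μ (A₁ d) := by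
    rw [measure_A₁ hF htrans hfin hbdry]
    refine measure_mono fun G hG => ?_
    rw [Set.mem_iInter] at hG
    refine ⟨Metric.mem_closure_iff.2 fun ε hε => ?_, (hG 0).2⟩
    obtain ⟨n, hn⟩ := exists_pow_lt_of_lt_one hε (by norm_num : (1 / 2 : ℝ) < 1)
    obtain ⟨y, hy, hyb⟩ := (hG n).1
    refine ⟨y, hy, ?_⟩
    rw [Metric.mem_ball, dist_comm] at hyb
    refine hyb.trans_le (le_trans ?_ hn.le)
    exact pow_le_pow_of_le_one (by norm_num) (by norm_num) (by omega)
  obtain ⟨n, hn⟩ := (hlim.eventually (gt_mem_nhds (hle.trans_lt ht))).exists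
  refine ⟨(1 / 2 : ℝ) ^ (n + 1), by positivity, ?_, hn⟩
  exact (pow_le_pow_of_le_one (by norm_num) (by norm_num) (by omega : 1 ≤ n + 1)).trans
    (by norm_num)

lemma exists_lt_measure_containBand (hF : IsSuitable d) (htrans : TranslationInvariant μ)
    (hfin : LocallyFinite μ) (hbdry : NullBoundaries μ) {t : ℝ≥0∞} (ht : t < μ (A₁ d)) :
    ∃ m : ℕ, t < μ (containBand 0 (0 : E d) ((2⁻¹ : ℝ) ^ m)) := by
  have hmono : Monotone fun n : ℕ => containBand 0 (0 : E d) ((2⁻¹ : ℝ) ^ n) := by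
    intro m n hmn G hG
    refine ⟨(Metric.ball_subset_ball ?_).trans hG.1, hG.2⟩
    exact pow_le_pow_of_le_one (by norm_num) (by norm_num) hmn
  have hlim := tendsto_measure_iUnion_atTop (μ := μ) hmono
  have hle : μ (A₁ d) ≤ μ (⋃ n : ℕ, containBand 0 (0 : E d) ((2⁻¹ : ℝ) ^ n)) := by
    rw [measure_A₁ hF htrans hfin hbdry]
    refine (measure_closureBand_le_interior hF htrans hfin hbdry).trans
      (measure_mono fun G hG => ?_)
    obtain ⟨ε, hε, hsub⟩ := Metric.mem_nhds_iff.1 (mem_interior_iff_mem_nhds.1 hG.1)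
    obtain ⟨n, hn⟩ := exists_pow_lt_of_lt_one hε (by norm_num : (2⁻¹ : ℝ) < 1)
    exact Set.mem_iUnion.2 ⟨n, (Metric.ball_subset_ball hn.le).trans hsub, hG.2⟩
  exact (hlim.eventually (lt_mem_nhds (ht.trans_le hle))).exists

end Mass

/-! ### Avoidance probabilities of Poisson processes -/

namespace PointProcess

variable {Ω X : Type*} [MeasurableSpace Ω] [MeasurableSpace X]

/-- The event that the point process has no point in `B`. -/
def avoid (Φ : PointProcess Ω X) (B : Set X) : Set Ω :=
  {ω | ∀ x ∈ Φ.points ω, x ∉ B}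

lemma countIn_preimage_zero (Φ : PointProcess Ω X) (B : Set X) :
    Φ.countIn B ⁻¹' {0} = Φ.avoid B := by
  ext ω
  simp only [Set.mem_preimage, Set.mem_singleton_iff, countIn, Set.encard_eq_zero,
    Set.eq_empty_iff_forall_notMem, avoid, points, Set.mem_ofPred_eq]
  constructor
  · rintro h x ⟨i, hi, rfl⟩ hx
    exact h i ⟨hi, hx⟩
  · rintro h i ⟨hi, hx⟩
    exact h _ ⟨i, hi, rfl⟩ hx

lemma measurableSet_avoid (Φ : PointProcess Ω X) {B : Set X} (hB : MeasurableSet B) :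
    MeasurableSet (Φ.avoid B) := by
  have : Φ.avoid B = ⋂ i : ℕ, ({ω | (i : ℕ∞) < Φ.count ω} ∩ Φ.point i ⁻¹' B)ᶜ := by
    ext ω
    simp only [avoid, points, Set.mem_ofPred_eq, Set.mem_iInter, Set.mem_compl_iff,
      Set.mem_inter_iff, Set.mem_preimage]
    constructor
    · rintro h i ⟨hi, hx⟩
      exact h _ ⟨i, hi, rfl⟩ hx
    · rintro h x ⟨i, hi, rfl⟩ hx
      exact h i ⟨hi, hx⟩
  rw [this]
  have hcount (i : ℕ) : MeasurableSet {ω | (i : ℕ∞) < Φ.count ω} :=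
    Φ.measurable_count (MeasurableSet.of_discrete (s := Set.Ioi (i : ℕ∞)))
  exact MeasurableSet.iInter fun i => ((hcount i).inter (Φ.measurable_point i hB)).compl

lemma avoid_union (Φ : PointProcess Ω X) (B C : Set X) :
    Φ.avoid (B ∪ C) = Φ.avoid B ∩ Φ.avoid C := by
  ext ω
  simp only [avoid, Set.mem_inter_iff, Set.mem_ofPred_eq, Set.mem_union, not_or]
  exact ⟨fun h => ⟨fun x hx => (h x hx).1, fun x hx => (h x hx).2⟩,
    fun h x hx => ⟨h.1 x hx, h.2 x hx⟩⟩

lemma IsPoisson.measure_avoid {Φ : PointProcess Ω X} {ν : Measure X} {P : Measure Ω}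
    (h : Φ.IsPoisson ν P) {B : Set X} (hB : MeasurableSet B) (hν : ν B ≠ ∞) :
    P (Φ.avoid B) = ENNReal.ofReal (Real.exp (-(ν B).toReal)) := by
  have hlaw := h.law_of_ne_top B hB hν
  have hcast : Measurable (Nat.cast : ℕ → ℕ∞) := measurable_from_nat
  -- `Measure.map` of a function that is not a.e. measurable is zero, which the law excludes.
  have hae : AEMeasurable (Φ.countIn B) P := by
    by_contra hcon
    rw [Measure.map_of_not_aemeasurable hcon] at hlaw
    have h1 : ((poissonMeasure (ν B).toNNReal).map (Nat.cast : ℕ → ℕ∞)) Set.univ = 1 := by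
      rw [Measure.map_apply hcast MeasurableSet.univ, Set.preimage_univ, measure_univ]
    rw [← hlaw] at h1
    simp at h1
  have h2 : P.map (Φ.countIn B) {0} = P (Φ.avoid B) := by
    rw [Measure.map_apply_of_aemeasurable hae (MeasurableSet.of_discrete), countIn_preimage_zero]
  have h3 : (Nat.cast : ℕ → ℕ∞) ⁻¹' {0} = {0} := by ext n; simp
  rw [← h2, hlaw, Measure.map_apply hcast (MeasurableSet.of_discrete), h3,
    poissonMeasure_singleton]
  simp [ENNReal.toReal]

end PointProcess

lemma pairwise_disjoint_band : Pairwise fun j k => Disjoint (band d j) (band d k) := by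
  have key : ∀ j k, j < k → Disjoint (band d j) (band d k) := by
    intro j k hjk
    rw [Set.disjoint_left]
    intro G hj hk
    have h1 : (2⁻¹ : ℝ≥0∞) ^ k ≤ (2⁻¹ : ℝ≥0∞) ^ (j + 1) :=
      pow_le_pow_right_of_le_one' (by simp) (by omega)
    exact absurd (hk.2.trans_le (h1.trans hj.1)) (lt_irrefl _)
  intro j k hjk
  rcases lt_or_gt_of_ne hjk with h | h
  · exact key j k h
  · exact (key k j h).symm

lemma measure_biUnion_of_subset_band [MeasurableSpace (Shape d)] {μ : Measure (Shape d)}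
    {F : ℕ → Set (Shape d)} (hF : ∀ k, MeasurableSet (F k)) (hsub : ∀ k, F k ⊆ band d k)
    {a : ℝ≥0∞} (ha : ∀ k, μ (F k) = a) (n : ℕ) :
    μ (⋃ k ∈ Finset.range n, F k) = n * a := by
  rw [measure_biUnion_finset (fun j _ k _ hjk => (pairwise_disjoint_band hjk).mono
    (hsub j) (hsub k)) (fun k _ => hF k)]
  simp [ha]

/-! ### Dyadic grids -/

/-- The point of the dyadic grid `2^{-N} ℤ^d` with integer coordinates `z`. -/
noncomputable def gridPoint (N : ℕ) (z : Fin d → ℤ) : E d :=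
  WithLp.toLp 2 fun i => (z i : ℝ) * (2⁻¹ : ℝ) ^ N

lemma dist_le_sqrt_mul {x y : E d} {t : ℝ} (ht : 0 ≤ t) (h : ∀ i, dist (x i) (y i) ≤ t) :
    dist x y ≤ √d * t := by
  rw [EuclideanSpace.dist_eq]
  calc √(∑ i, dist (x i) (y i) ^ 2) ≤ √(∑ _i : Fin d, t ^ 2) :=
        Real.sqrt_le_sqrt (Finset.sum_le_sum fun i _ => pow_le_pow_left₀ dist_nonneg (h i) 2)
    _ = √d * t := by simp [Real.sqrt_sq ht]

lemma sqrt_lt_two_pow (d : ℕ) : √(d : ℝ) < 2 ^ d := by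
  rw [Real.sqrt_lt' (by positivity)]
  have h1 : (d : ℝ) < 2 ^ d := by exact_mod_cast Nat.lt_two_pow_self
  nlinarith [one_le_pow₀ (one_le_two : (1 : ℝ) ≤ 2) (n := d)]

lemma exists_gridPoint_dist_lt (N R : ℕ) {x : E d} (hx : ∀ i, |x i| ≤ R) :
    ∃ z ∈ Fintype.piFinset fun _ : Fin d =>
        Finset.Icc (-((R * 2 ^ (N + d) : ℕ) : ℤ)) ((R * 2 ^ (N + d) : ℕ) : ℤ),
      dist x (gridPoint (N + d) z) < (2⁻¹ : ℝ) ^ N := by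
  have h2 : (0 : ℝ) < 2 ^ (N + d) := by positivity
  refine ⟨fun i => ⌊x i * 2 ^ (N + d)⌋, ?_, ?_⟩
  · rw [Fintype.mem_piFinset]
    intro i
    obtain ⟨h1, h3⟩ := abs_le.1 (hx i)
    rw [Finset.mem_Icc]
    constructor
    · rw [Int.le_floor]
      push_cast
      nlinarith
    · have hfl := Int.floor_le (x i * 2 ^ (N + d))
      have : ((⌊x i * 2 ^ (N + d)⌋ : ℤ) : ℝ) ≤ (((R * 2 ^ (N + d) : ℕ) : ℤ) : ℝ) := by
        push_cast
        nlinarith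
      exact_mod_cast this
  · have hinv : (2⁻¹ : ℝ) ^ (N + d) * 2 ^ (N + d) = 1 := by
      rw [← mul_pow]; norm_num
    have h0 : (0 : ℝ) ≤ (2⁻¹ : ℝ) ^ (N + d) := by positivity
    have hle : dist x (gridPoint (N + d) fun i => ⌊x i * 2 ^ (N + d)⌋) ≤
        √d * (2⁻¹ : ℝ) ^ (N + d) := by
      refine dist_le_sqrt_mul h0 fun i => ?_
      have e : x i = x i * 2 ^ (N + d) * (2⁻¹ : ℝ) ^ (N + d) := by
        rw [mul_assoc, mul_comm (2 ^ (N + d) : ℝ), hinv, mul_one]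
      change dist (x i) ((⌊x i * 2 ^ (N + d)⌋ : ℝ) * (2⁻¹ : ℝ) ^ (N + d)) ≤ _
      nth_rw 1 [e]
      rw [Real.dist_eq, ← sub_mul, abs_mul, abs_of_nonneg h0, Int.self_sub_floor,
        abs_of_nonneg (Int.fract_nonneg _)]
      exact mul_le_of_le_one_left h0 (Int.fract_lt_one _).le
    refine hle.trans_lt ?_
    rw [pow_add, mul_left_comm]
    refine mul_lt_of_lt_one_right (by positivity) ?_
    rw [inv_pow, ← div_eq_mul_inv, div_lt_one (by positivity)]
    exact sqrt_lt_two_pow d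

lemma card_grid_le (N R : ℕ) (hR : 1 ≤ R) :
    (((Fintype.piFinset fun _ : Fin d =>
      Finset.Icc (-((R * 2 ^ N : ℕ) : ℤ)) ((R * 2 ^ N : ℕ) : ℤ)).card : ℕ) : ℝ) ≤
      (3 * R : ℝ) ^ d * (2 ^ d) ^ N := by
  have hcard : (Finset.Icc (-((R * 2 ^ N : ℕ) : ℤ)) ((R * 2 ^ N : ℕ) : ℤ)).card ≤
      3 * R * 2 ^ N := by
    rw [Int.card_Icc]
    have : 1 ≤ R * 2 ^ N := Nat.one_le_iff_ne_zero.2 (by positivity)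
    have : 3 * R * 2 ^ N = 3 * (R * 2 ^ N) := by ring
    omega
  rw [Fintype.card_piFinset, Finset.prod_const, Finset.card_univ, Fintype.card_fin,
    ← pow_mul, mul_comm d N, pow_mul, ← mul_pow, Nat.cast_pow]
  exact pow_le_pow_left₀ (by positivity) (by exact_mod_cast hcard) d

/-! ### Covering above the critical intensity -/

section Covering

variable [MeasurableSpace (Shape d)] {μ : Measure (Shape d)}

/-- The first moment method: once the mass of the shapes of one dyadic band that contain a small
ball exceeds `d log 2 / l`, the expected number of uncovered grid balls tends to zero. -/
lemma ae_vacantSet_eq_empty (hF : IsSuitable d) (htrans : TranslationInvariant μ)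
    (hscale : SemiScaleInvariant μ) (hfin : LocallyFinite μ)
    {Ω : Type*} [MeasurableSpace Ω] {P : Measure Ω} [IsProbabilityMeasure P]
    {Φ : PointProcess Ω (Shape d)} {l : ℝ≥0} (hΦ : Φ.IsPoisson ((l : ℝ≥0∞) • μ) P) {m : ℕ}
    (hl : d * Real.log 2 < l * (μ (containBand 0 (0 : E d) ((2⁻¹ : ℝ) ^ m))).toReal) :
    ∀ᵐ ω ∂P, vacantSet Φ ω = ∅ := by
  have hr : (0 : ℝ) < (2⁻¹ : ℝ) ^ m := by positivity
  set a := μ (containBand 0 (0 : E d) ((2⁻¹ : ℝ) ^ m)) with ha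
  have hatop : a ≠ ∞ := ((measure_mono (containBand_subset_hitBand hr)).trans_lt
    (hfin.measure_hitBand_lt_top 0 0 _)).ne
  set D : ℕ → E d → Set (Shape d) := fun n x =>
    ⋃ k ∈ Finset.range n, containBand k x ((2⁻¹ : ℝ) ^ k * (2⁻¹ : ℝ) ^ m) with hD
  have hDm : ∀ n x, MeasurableSet (D n x) := fun n x =>
    Finset.measurableSet_biUnion _ fun k _ => hF.measurableSet_containBand k x _
  have hDμ : ∀ n x, μ (D n x) = n * a := fun n x =>
    measure_biUnion_of_subset_band (fun k => hF.measurableSet_containBand k x _)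
      (fun k => Set.inter_subset_right)
      (fun k => measure_containBand hF htrans hscale hfin k x hr) n
  set ρ : ℝ := 2 ^ d * Real.exp (-(l * a.toReal)) with hρ
  have hρ0 : 0 ≤ ρ := by positivity
  have hρ1 : ρ < 1 := by
    have : (2 : ℝ) ^ d = Real.exp (d * Real.log 2) := by
      rw [mul_comm, Real.exp_mul, Real.exp_log two_pos, Real.rpow_natCast]
    rw [hρ, this, ← Real.exp_add, Real.exp_lt_one_iff]
    linarith
  have hDP : ∀ n x, P (Φ.avoid (D n x)) = ENNReal.ofReal (Real.exp (-(l * a.toReal)) ^ n) := by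
    intro n x
    have hval : ((l : ℝ≥0∞) • μ) (D n x) = l * (n * a) := by
      rw [Measure.smul_apply, hDμ, smul_eq_mul]
    rw [hΦ.measure_avoid (hDm n x) (by rw [hval]; finiteness), hval, ← Real.exp_nat_mul]
    congr 2
    simp
    ring
  have hR : ∀ R : ℕ, 1 ≤ R → P {ω | ∃ x ∈ vacantSet Φ ω, ∀ i, |x i| ≤ R} = 0 := by
    intro R hR
    have hbound : ∀ n : ℕ, P {ω | ∃ x ∈ vacantSet Φ ω, ∀ i, |x i| ≤ R} ≤
        ENNReal.ofReal ((3 * R : ℝ) ^ d * (2 ^ d) ^ (m + d) * ρ ^ n) := by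
      intro n
      set Z := Fintype.piFinset fun _ : Fin d =>
        Finset.Icc (-((R * 2 ^ (n + m + d) : ℕ) : ℤ)) ((R * 2 ^ (n + m + d) : ℕ) : ℤ)
      have hsub : {ω | ∃ x ∈ vacantSet Φ ω, ∀ i, |x i| ≤ R} ⊆
          ⋃ z ∈ Z, Φ.avoid (D n (gridPoint (n + m + d) z)) := by
        rintro ω ⟨x, hx, hxR⟩
        obtain ⟨z, hz, hxz⟩ := exists_gridPoint_dist_lt (n + m) R hxR
        refine Set.mem_biUnion hz fun G hG hGD => hx ?_
        simp only [hD, Set.mem_iUnion, exists_prop, Finset.mem_range] at hGD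
        obtain ⟨k, hk, hGk⟩ := hGD
        refine Set.mem_biUnion hG (hGk.1 (hxz.trans_le ?_))
        rw [← pow_add]
        exact pow_le_pow_of_le_one (by norm_num) (by norm_num) (by omega)
      calc P {ω | ∃ x ∈ vacantSet Φ ω, ∀ i, |x i| ≤ R}
          ≤ ∑ z ∈ Z, P (Φ.avoid (D n (gridPoint (n + m + d) z))) :=
            (measure_mono hsub).trans (measure_biUnion_finset_le _ _)
        _ = ENNReal.ofReal (Z.card * Real.exp (-(l * a.toReal)) ^ n) := by
            simp only [hDP, Finset.sum_const, nsmul_eq_mul]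
            rw [ENNReal.ofReal_mul (by positivity), ENNReal.ofReal_natCast]
        _ ≤ _ := by
            refine ENNReal.ofReal_le_ofReal ?_
            calc (Z.card : ℝ) * Real.exp (-(l * a.toReal)) ^ n
                ≤ ((3 * R : ℝ) ^ d * (2 ^ d) ^ (n + m + d)) * Real.exp (-(l * a.toReal)) ^ n :=
                  mul_le_mul_of_nonneg_right (card_grid_le _ R hR) (by positivity)
              _ = _ := by rw [hρ, mul_pow]; ring
    have hlim : Tendsto (fun n : ℕ => ENNReal.ofReal ((3 * R : ℝ) ^ d * (2 ^ d) ^ (m + d) * ρ ^ n))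
        atTop (𝓝 0) := by
      rw [← ENNReal.ofReal_zero]
      refine ENNReal.tendsto_ofReal ?_
      simpa using (tendsto_pow_atTop_nhds_zero_of_lt_one hρ0 hρ1).const_mul
        ((3 * R : ℝ) ^ d * (2 ^ d) ^ (m + d))
    exact le_antisymm (ge_of_tendsto' hlim hbound) bot_le
  rw [ae_iff]
  refine measure_mono_null (t := ⋃ R : ℕ, {ω | ∃ x ∈ vacantSet Φ ω, ∀ i, |x i| ≤ (R + 1 : ℕ)})
    ?_ (measure_iUnion_null fun R => hR (R + 1) (by omega))
  intro ω hω
  obtain ⟨x, hx⟩ := Set.nonempty_iff_ne_empty.2 hω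
  obtain ⟨R, hRx⟩ := exists_nat_gt ‖x‖
  refine Set.mem_iUnion.2 ⟨R, x, hx, fun i => ?_⟩
  have h1 : ‖x i‖ ≤ ‖x‖ := PiLp.norm_apply_le x i
  rw [Real.norm_eq_abs] at h1
  push_cast
  linarith

end Covering

/-! ### A truncated second moment method -/

section SecondMoment

variable {Ω ι : Type*} [Fintype ι]

open Classical in
/-- The indices of those events of the family `A` that occur at `ω`. -/
noncomputable def occurring (A : ι → Set Ω) (ω : Ω) : Finset ι := {x | ω ∈ A x}

/-- The event that at least `T / 2` events of the family `A` occur, while the `w`-weighted number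
of pairs of occurring events is at most `(L * T) ^ 2`. -/
def spreadEvent (A : ι → Set Ω) (w : ι → ι → ℝ) (T L : ℝ) : Set Ω :=
  {ω | T / 2 ≤ ((occurring A ω).card : ℝ) ∧
    ∑ x ∈ occurring A ω, ∑ y ∈ occurring A ω, w x y ≤ (L * T) ^ 2}

lemma mem_occurring {A : ι → Set Ω} {ω : Ω} {x : ι} : x ∈ occurring A ω ↔ ω ∈ A x := by
  simp [occurring]

lemma card_occurring_eq (A : ι → Set Ω) (ω : Ω) :
    ((occurring A ω).card : ℝ) = ∑ x, (A x).indicator (fun _ => (1 : ℝ)) ω := by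
  classical
  simp [occurring, Set.indicator_apply]

lemma sum_occurring_eq (A : ι → Set Ω) (w : ι → ι → ℝ) (ω : Ω) :
    ∑ x ∈ occurring A ω, ∑ y ∈ occurring A ω, w x y =
      ∑ x, ∑ y, (A x ∩ A y).indicator (fun _ => w x y) ω := by
  classical
  simp only [occurring, Finset.sum_filter, Set.indicator_apply, Set.mem_inter_iff]
  refine Finset.sum_congr rfl fun x _ => ?_
  split_ifs with h <;> simp [h]

variable [MeasurableSpace Ω]

lemma measurableSet_spreadEvent {A : ι → Set Ω} (hA : ∀ x, MeasurableSet (A x))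
    (w : ι → ι → ℝ) (T L : ℝ) : MeasurableSet (spreadEvent A w T L) := by
  simp only [spreadEvent, card_occurring_eq, sum_occurring_eq]
  have h1 : Measurable fun ω => ∑ x, (A x).indicator (fun _ => (1 : ℝ)) ω :=
    Finset.measurable_fun_sum _ fun x _ => measurable_const.indicator (hA x)
  have h2 : Measurable fun ω => ∑ x, ∑ y, (A x ∩ A y).indicator (fun _ => w x y) ω :=
    Finset.measurable_fun_sum _ fun x _ => Finset.measurable_fun_sum _ fun y _ =>
      measurable_const.indicator ((hA x).inter (hA y))
  exact (measurableSet_le measurable_const h1).inter (measurableSet_le h2 measurable_const)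

/-- If the weighted second moment is at most `C` times the square of the first moment, then the
spread event has probability bounded from below. -/
lemma le_measureReal_spreadEvent {P : Measure Ω} [IsProbabilityMeasure P] {A : ι → Set Ω}
    (hA : ∀ x, MeasurableSet (A x)) {w : ι → ι → ℝ} (hw : ∀ x y, 1 ≤ w x y) {T C : ℝ}
    (hT : 0 < T) (hC : 0 < C) (h1 : ∑ x, P.real (A x) = T)
    (h2 : ∑ x, ∑ y, w x y * P.real (A x ∩ A y) ≤ C * T ^ 2) :
    1 / (16 * C) ≤ P.real (spreadEvent A w T (4 * C)) := by
  classical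
  set X : Ω → ℝ := fun ω => ∑ x, (A x).indicator (fun _ => (1 : ℝ)) ω with hX
  set Y : Ω → ℝ := fun ω => ∑ x, ∑ y, (A x ∩ A y).indicator (fun _ => w x y) ω with hY
  set S := spreadEvent A w T (4 * C) with hS
  have hSm : MeasurableSet S := measurableSet_spreadEvent hA w T (4 * C)
  have hIX : ∀ x, Integrable ((A x).indicator fun _ => (1 : ℝ)) P := fun x =>
    (integrable_const _).indicator (hA x)
  have hIY : ∀ x y, Integrable ((A x ∩ A y).indicator fun _ => w x y) P := fun x y =>
    (integrable_const _).indicator ((hA x).inter (hA y))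
  have hIYx : ∀ x, Integrable (fun ω => ∑ y, (A x ∩ A y).indicator (fun _ => w x y) ω) P :=
    fun x => integrable_finsetSum _ fun y _ => hIY x y
  have hXint : Integrable X P := integrable_finsetSum _ fun x _ => hIX x
  have hYint : Integrable Y P := integrable_finsetSum _ fun x _ => hIYx x
  have hSint : Integrable (S.indicator fun _ => (1 : ℝ)) P := (integrable_const _).indicator hSm
  have hEX : ∫ ω, X ω ∂P = T := by
    rw [hX, integral_finsetSum _ fun x _ => hIX x, ← h1]
    refine Finset.sum_congr rfl fun x _ => ?_
    rw [integral_indicator (hA x)]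
    simp
  have hEY : ∫ ω, Y ω ∂P ≤ C * T ^ 2 := by
    refine le_trans (le_of_eq ?_) h2
    rw [hY, integral_finsetSum _ fun x _ => hIYx x]
    refine Finset.sum_congr rfl fun x _ => ?_
    rw [integral_finsetSum _ fun y _ => hIY x y]
    refine Finset.sum_congr rfl fun y _ => ?_
    rw [integral_indicator ((hA x).inter (hA y))]
    simp [mul_comm]
  have hXY : ∀ ω, X ω ^ 2 ≤ Y ω := by
    intro ω
    have e1 : X ω = ((occurring A ω).card : ℝ) := (card_occurring_eq A ω).symm
    have e2 : Y ω = ∑ x ∈ occurring A ω, ∑ y ∈ occurring A ω, w x y :=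
      (sum_occurring_eq A w ω).symm
    rw [e1, e2]
    calc ((occurring A ω).card : ℝ) ^ 2
        = ∑ _x ∈ occurring A ω, ∑ _y ∈ occurring A ω, (1 : ℝ) := by simp [sq]
      _ ≤ _ := Finset.sum_le_sum fun x _ => Finset.sum_le_sum fun y _ => hw x y
  have hX0 : ∀ ω, 0 ≤ X ω := fun ω => Finset.sum_nonneg fun x _ =>
    Set.indicator_nonneg (fun _ _ => zero_le_one) _
  have hLT : 0 < 4 * C * T := by positivity
  -- Off the spread event, either `X < T / 2`, or `Y` is so large that `X ≤ √Y` is a small multiple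
  -- of `Y`.
  have hpt : ∀ ω, X ω ≤ T / 2 + 4 * C * T * S.indicator (fun _ => (1 : ℝ)) ω +
      Y ω / (4 * C * T) := by
    intro ω
    have hY0 : 0 ≤ Y ω := (sq_nonneg _).trans (hXY ω)
    have hYL : 0 ≤ Y ω / (4 * C * T) := by positivity
    by_cases hω : ω ∈ S
    · rw [Set.indicator_of_mem hω]
      have h3 : X ω ^ 2 ≤ (4 * C * T) ^ 2 := by
        refine (hXY ω).trans (le_of_eq_of_le (sum_occurring_eq A w ω).symm hω.2)
      have h4 := abs_le_of_sq_le_sq h3 hLT.le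
      linarith [le_abs_self (X ω)]
    · rw [Set.indicator_of_notMem hω]
      by_cases hsmall : X ω < T / 2
      · linarith
      · have hbig : (4 * C * T) ^ 2 < Y ω := by
          by_contra! hcon
          refine hω ⟨?_, ?_⟩
          · rw [card_occurring_eq]; exact not_lt.1 hsmall
          · rw [sum_occurring_eq]; exact hcon
        have h5 : X ω ≤ Y ω / (4 * C * T) := by
          rw [le_div_iff₀ hLT]
          rcases le_total (X ω) (4 * C * T) with h6 | h6
          · nlinarith [hX0 ω]
          · nlinarith [hXY ω, hX0 ω]
        linarith
  have hI1 : Integrable (fun _ : Ω => T / 2) P := integrable_const _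
  have hI2 : Integrable (fun ω => 4 * C * T * S.indicator (fun _ => (1 : ℝ)) ω) P :=
    hSint.const_mul _
  have hI12 : Integrable
      (fun ω => T / 2 + 4 * C * T * S.indicator (fun _ => (1 : ℝ)) ω) P := hI1.add hI2
  have hI3 : Integrable (fun ω => Y ω / (4 * C * T)) P := hYint.div_const _
  have hint := integral_mono hXint (hI12.add hI3) hpt
  rw [hEX] at hint
  simp only [Pi.add_apply] at hint
  rw [integral_add hI12 hI3, integral_add hI1 hI2, integral_const_mul,
    integral_indicator hSm] at hint
  simp only [integral_const, probReal_univ, smul_eq_mul, one_mul, mul_one,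
    measureReal_restrict_apply_univ] at hint
  have hYT : ∫ ω, Y ω / (4 * C * T) ∂P ≤ T / 4 := by
    rw [integral_div, div_le_iff₀ hLT]
    nlinarith
  rw [div_le_iff₀ (by positivity)]
  have : T * 1 ≤ T * (P.real S * (16 * C)) := by linarith
  exact le_of_mul_le_mul_left this hT

end SecondMoment

/-- Events with probabilities bounded from below occur infinitely often with positive
probability. -/
lemma measure_frequently_pos {Ω : Type*} [MeasurableSpace Ω] {P : Measure Ω}
    [IsProbabilityMeasure P] {S : ℕ → Set Ω} (hS : ∀ n, MeasurableSet (S n)) {c : ℝ} (hc : 0 < c)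
    (h : ∀ n, c ≤ P.real (S n)) : 0 < P {ω | ∃ᶠ n in atTop, ω ∈ S n} := by
  have heq : {ω | ∃ᶠ n in atTop, ω ∈ S n} = ⋂ N : ℕ, ⋃ n ≥ N, S n := by
    ext ω
    simp [frequently_atTop]
  have hanti : Antitone fun N : ℕ => ⋃ n ≥ N, S n := fun M N hMN =>
    Set.biUnion_subset_biUnion_left fun n hn => le_trans hMN hn
  have hlim := tendsto_measure_iInter_atTop (μ := P) (fun N : ℕ =>
    (MeasurableSet.biUnion (Set.to_countable {n | n ≥ N}) fun n _ => hS n).nullMeasurableSet)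
    hanti ⟨0, measure_ne_top _ _⟩
  rw [heq]
  refine (ENNReal.ofReal_pos.2 hc).trans_le (ge_of_tendsto' hlim fun N => ?_)
  calc ENNReal.ofReal c ≤ P (S N) := by
        rw [ENNReal.ofReal_le_iff_le_toReal (measure_ne_top _ _)]; exact h N
    _ ≤ _ := measure_mono (Set.subset_biUnion_of_mem (u := S) (show N ∈ Set.Ici N from Set.self_mem_Ici))

/-! ### Uncountability of limit sets carrying spread-out point clouds -/

/-- The number of scales `k < n` at which two points are `2 * 2^{-k}`-close. -/
noncomputable def closeScales {X : Type*} [PseudoMetricSpace X] (n : ℕ) (x y : X) : Finset ℕ :=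
  {k ∈ Finset.range n | dist x y < 2 * (2⁻¹ : ℝ) ^ k}

/-- Suppose that each of infinitely many sets `K n` carries a point cloud of mass at least `1 / 2`
and of bounded energy, where a point has mass `1 / T n` and the energy kernel at two points is
`τ ^ 2` to the power of the number of scales at which they are close. Bounded energy makes the clouds uniformly
non-atomic, so no countable set can contain the intersection of the sets `K n`. -/
lemma not_countable_iInter {X : Type*} [MetricSpace X] {K : ℕ → Set X}
    (hK : ∀ n, IsCompact (K n)) (hanti : Antitone K) {ι : ℕ → Type*} (g : ∀ n, ι n → X)
    (F : ∀ n, Finset (ι n)) (hFK : ∀ n, ∀ x ∈ F n, g n x ∈ K n) {T : ℕ → ℝ} (hT : ∀ n, 0 < T n)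
    {L τ : ℝ} (hL : 0 < L) (hτ : 1 < τ)
    (hfreq : ∃ᶠ n in atTop, T n / 2 ≤ ((F n).card : ℝ) ∧
      ∑ x ∈ F n, ∑ y ∈ F n, (τ ^ 2) ^ (closeScales n (g n x) (g n y)).card ≤ (L * T n) ^ 2) :
    ¬ (⋂ n, K n).Countable := by
  classical
  intro hcount
  have hXne : Nonempty X := by
    obtain ⟨n, hn, -⟩ := hfreq.exists
    have : (0 : ℝ) < (F n).card := (half_pos (hT n)).trans_le hn
    obtain ⟨x, -⟩ := Finset.card_pos.1 (Nat.cast_pos.1 this)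
    exact ⟨g n x⟩
  obtain ⟨f, hf⟩ := Set.countable_iff_exists_subset_range.1 hcount
  have hτ0 : 0 < τ := one_pos.trans hτ
  -- Radii so small that the masses of the balls around the points `f i` sum to at most `1 / 4`.
  have hj : ∀ i : ℕ, ∃ j : ℕ, L * τ⁻¹ ^ j < 1 / 4 * (1 / 2 / 2 ^ i) := by
    intro i
    obtain ⟨j, hj⟩ := exists_pow_lt_of_lt_one
      (show (0 : ℝ) < 1 / 4 * (1 / 2 / 2 ^ i) / L by positivity) (inv_lt_one_of_one_lt₀ hτ)
    exact ⟨j, by rwa [lt_div_iff₀' hL] at hj⟩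
  choose j hj using hj
  have hopen : ∀ i, IsOpen (Metric.ball (f i) ((2⁻¹ : ℝ) ^ j i)) := fun i => Metric.isOpen_ball
  have hcover : ⋂ n, K n ⊆ ⋃ i, Metric.ball (f i) ((2⁻¹ : ℝ) ^ j i) := by
    intro x hx
    obtain ⟨i, rfl⟩ := hf hx
    exact Set.mem_iUnion.2 ⟨i, Metric.mem_ball_self (by positivity)⟩
  obtain ⟨n₀, hn₀⟩ := exists_subset_nhds_of_isCompact hanti.directed_ge hK
    (fun x hx => (isOpen_iUnion hopen).mem_nhds (hcover hx))
  obtain ⟨t, ht⟩ := (hK n₀).elim_finite_subcover _ hopen hn₀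
  have hev : ∀ᶠ n in atTop, n₀ ≤ n ∧ ∀ i ∈ t, j i < n :=
    (eventually_ge_atTop n₀).and ((Finset.eventually_all t).2 fun i _ => eventually_gt_atTop (j i))
  obtain ⟨n, ⟨hmass, henergy⟩, hn, hjn⟩ := (hfreq.and_eventually hev).exists
  set B : ℕ → Finset (ι n) := fun i =>
    {x ∈ F n | g n x ∈ Metric.ball (f i) ((2⁻¹ : ℝ) ^ j i)} with hB
  have hsub : F n ⊆ t.biUnion B := by
    intro x hx
    obtain ⟨i, hi, hxi⟩ := Set.mem_iUnion₂.1 (ht (hanti hn (hFK n x hx)))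
    exact Finset.mem_biUnion.2 ⟨i, hi, Finset.mem_filter.2 ⟨hx, hxi⟩⟩
  have hpow : ∀ m : ℕ, (1 : ℝ) ≤ (τ ^ 2) ^ m := fun m => one_le_pow₀ (one_le_pow₀ hτ.le)
  have hball : ∀ i ∈ t, ((B i).card : ℝ) ≤ T n * (1 / 4 * (1 / 2 / 2 ^ i)) := by
    intro i hi
    have h1 : ((B i).card : ℝ) ^ 2 * (τ ^ 2) ^ j i ≤ (L * T n) ^ 2 := by
      refine le_trans ?_ henergy
      calc ((B i).card : ℝ) ^ 2 * (τ ^ 2) ^ j i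
          = ∑ _x ∈ B i, ∑ _y ∈ B i, (τ ^ 2) ^ j i := by
            simp only [Finset.sum_const, nsmul_eq_mul]; ring
        _ ≤ ∑ x ∈ B i, ∑ y ∈ B i, (τ ^ 2) ^ (closeScales n (g n x) (g n y)).card := by
            refine Finset.sum_le_sum fun x hx => Finset.sum_le_sum fun y hy => ?_
            refine pow_le_pow_right₀ (one_le_pow₀ hτ.le) ?_
            have hxy : dist (g n x) (g n y) < 2 * (2⁻¹ : ℝ) ^ j i := by
              have hx' := (Finset.mem_filter.1 hx).2
              have hy' := (Finset.mem_filter.1 hy).2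
              rw [Metric.mem_ball] at hx' hy'
              rw [dist_comm] at hy'
              linarith [dist_triangle (g n x) (f i) (g n y)]
            calc j i = (Finset.range (j i)).card := (Finset.card_range _).symm
              _ ≤ _ := by
                refine Finset.card_le_card fun k hk => ?_
                rw [Finset.mem_range] at hk
                refine Finset.mem_filter.2 ⟨Finset.mem_range.2 (hk.trans (hjn i hi)),
                  hxy.trans_le ?_⟩
                have := pow_le_pow_of_le_one (by norm_num : (0 : ℝ) ≤ 2⁻¹) (by norm_num) hk.le
                linarith
        _ ≤ ∑ x ∈ B i, ∑ y ∈ F n, (τ ^ 2) ^ (closeScales n (g n x) (g n y)).card :=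
            Finset.sum_le_sum fun x _ => Finset.sum_le_sum_of_subset_of_nonneg
              (Finset.filter_subset _ _) fun _ _ _ => zero_le_one.trans (hpow _)
        _ ≤ _ := Finset.sum_le_sum_of_subset_of_nonneg (Finset.filter_subset _ _)
              fun _ _ _ => Finset.sum_nonneg fun _ _ => zero_le_one.trans (hpow _)
    have h2 : ((B i).card : ℝ) * τ ^ j i ≤ L * T n := by
      refine (le_abs_self _).trans (abs_le_of_sq_le_sq ?_ (mul_pos hL (hT n)).le)
      rw [mul_pow, ← pow_mul, mul_comm (j i) 2, pow_mul]
      exact h1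
    have h3 : ((B i).card : ℝ) ≤ T n * (L * τ⁻¹ ^ j i) := by
      have hτj : (0 : ℝ) < τ ^ j i := by positivity
      rw [inv_pow, ← div_eq_mul_inv, mul_div_assoc', le_div_iff₀ hτj]
      linarith
    exact h3.trans (mul_le_mul_of_nonneg_left (hj i).le (hT n).le)
  have hsum : ((F n).card : ℝ) ≤ T n / 4 := by
    calc ((F n).card : ℝ) ≤ ∑ i ∈ t, ((B i).card : ℝ) := by
          exact_mod_cast (Finset.card_le_card hsub).trans Finset.card_biUnion_le
      _ ≤ ∑ i ∈ t, T n * (1 / 4 * (1 / 2 / 2 ^ i)) := Finset.sum_le_sum hball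
      _ = T n / 4 * ∑ i ∈ t, (1 / 2 / 2 ^ i : ℝ) := by
          rw [Finset.mul_sum]; exact Finset.sum_congr rfl fun i _ => by ring
      _ ≤ T n / 4 * 1 := by
          refine mul_le_mul_of_nonneg_left ?_ (by linarith [hT n])
          have h := (summable_geometric_two' (1 : ℝ)).sum_le_tsum t fun i _ => by positivity
          rwa [tsum_geometric_two'] at h
      _ = T n / 4 := mul_one _
  linarith [hT n]

/-! ### Energy of the dyadic grid -/

/-- A set of natural numbers with maximum `k` has at most `k + 1` elements, so the power
is dominated by the term of `k`. -/
lemma pow_card_le_one_add_sum {s : ℝ} (hs : 1 ≤ s) (S : Finset ℕ) :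
    s ^ S.card ≤ 1 + ∑ k ∈ S, s ^ (k + 1) := by
  have hs0 : 0 ≤ s := zero_le_one.trans hs
  rcases S.eq_empty_or_nonempty with rfl | hne
  · simp
  · have hsub : S ⊆ Finset.range (S.max' hne + 1) := fun k hk =>
      Finset.mem_range.2 (Nat.lt_succ_of_le (S.le_max' k hk))
    have hcard : S.card ≤ S.max' hne + 1 := by simpa using Finset.card_le_card hsub
    calc s ^ S.card ≤ s ^ (S.max' hne + 1) := pow_le_pow_right₀ hs hcard
      _ ≤ ∑ k ∈ S, s ^ (k + 1) :=
        Finset.single_le_sum (f := fun k => s ^ (k + 1)) (fun k _ => by positivity)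
          (S.max'_mem hne)
      _ ≤ _ := by linarith

/-- The point of the grid `2^{-n} ℤ^d ∩ [0, 1)^d` with index `z`. -/
noncomputable def unitGrid (n : ℕ) (z : Fin d → Fin (2 ^ n)) : E d :=
  gridPoint n fun i => ((z i : ℕ) : ℤ)

lemma dist_unitGrid_zero_le (n : ℕ) (z : Fin d → Fin (2 ^ n)) : dist (unitGrid n z) 0 ≤ √d := by
  have h := dist_le_sqrt_mul (x := unitGrid n z) (y := 0) zero_le_one fun i => ?_
  · rwa [mul_one] at h
  · change dist ((((z i : ℕ) : ℤ) : ℝ) * (2⁻¹ : ℝ) ^ n) 0 ≤ 1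
    rw [Real.dist_0_eq_abs, abs_of_nonneg (by positivity), inv_pow, ← div_eq_mul_inv,
      div_le_one (by positivity)]
    exact_mod_cast (z i).isLt.le

lemma card_close_le (n k : ℕ) (hk : k ≤ n) (x : Fin d → Fin (2 ^ n)) :
    (({y | dist (unitGrid n x) (unitGrid n y) < 2 * (2⁻¹ : ℝ) ^ k} :
      Finset (Fin d → Fin (2 ^ n))).card : ℝ) ≤ 4 ^ d * (2 ^ d) ^ n * (((2 : ℝ) ^ d)⁻¹) ^ k := by
  classical
  set b : ℕ := 2 ^ (n + 1 - k) with hb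
  set J : Fin d → Finset (Fin (2 ^ n)) := fun i =>
    {j | |((j : ℕ) : ℤ) - ((x i : ℕ) : ℤ)| < b} with hJ
  have hJcard : ∀ i, (J i).card ≤ 2 * b := by
    intro i
    have hinj : Set.InjOn (fun j : Fin (2 ^ n) => ((j : ℕ) : ℤ)) (J i) := by
      intro j _ j' _ h
      exact Fin.ext (Int.ofNat.inj h)
    rw [← Finset.card_image_of_injOn hinj]
    have hsub : (J i).image (fun j : Fin (2 ^ n) => ((j : ℕ) : ℤ)) ⊆
        Finset.Ico (((x i : ℕ) : ℤ) - b) (((x i : ℕ) : ℤ) + b) := by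
      intro z hz
      obtain ⟨j, hj, rfl⟩ := Finset.mem_image.1 hz
      have hj' := abs_lt.1 (Finset.mem_filter.1 hj).2
      rw [Finset.mem_Ico]
      constructor <;> linarith [hj'.1, hj'.2]
    refine (Finset.card_le_card hsub).trans ?_
    rw [Int.card_Ico]
    omega
  have hsub : ({y | dist (unitGrid n x) (unitGrid n y) < 2 * (2⁻¹ : ℝ) ^ k} :
      Finset (Fin d → Fin (2 ^ n))) ⊆ Fintype.piFinset J := by
    intro y hy
    rw [Fintype.mem_piFinset]
    intro i
    refine Finset.mem_filter.2 ⟨Finset.mem_univ _, ?_⟩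
    have hy' := (Finset.mem_filter.1 hy).2
    have h1 : dist (unitGrid n x i) (unitGrid n y i) < 2 * (2⁻¹ : ℝ) ^ k := by
      refine lt_of_le_of_lt ?_ hy'
      rw [dist_eq_norm, dist_eq_norm]
      exact PiLp.norm_apply_le (unitGrid n x - unitGrid n y) i
    change dist ((((x i : ℕ) : ℤ) : ℝ) * (2⁻¹ : ℝ) ^ n) ((((y i : ℕ) : ℤ) : ℝ) * (2⁻¹ : ℝ) ^ n) < _
      at h1
    rw [dist_comm, Real.dist_eq, ← sub_mul, abs_mul,
      abs_of_nonneg (by positivity : (0 : ℝ) ≤ (2⁻¹ : ℝ) ^ n), inv_pow, ← div_eq_mul_inv,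
      div_lt_iff₀ (by positivity)] at h1
    have h2 : 2 * (2⁻¹ : ℝ) ^ k * 2 ^ n = (b : ℝ) := by
      rw [hb, inv_pow]
      push_cast
      rw [pow_sub₀ _ two_ne_zero (by omega), pow_succ]
      ring
    rw [h2] at h1
    exact_mod_cast h1
  have hcard : ({y | dist (unitGrid n x) (unitGrid n y) < 2 * (2⁻¹ : ℝ) ^ k} :
      Finset (Fin d → Fin (2 ^ n))).card ≤ (2 * b) ^ d := by
    refine (Finset.card_le_card hsub).trans ?_
    rw [Fintype.card_piFinset]
    calc ∏ i, (J i).card ≤ ∏ _i : Fin d, 2 * b := Finset.prod_le_prod' fun i _ => hJcard i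
      _ = _ := by simp
  refine (Nat.cast_le.2 hcard).trans (le_of_eq ?_)
  have h3 : (2 : ℝ) * b = 4 * 2 ^ n * (2⁻¹ : ℝ) ^ k := by
    rw [hb, inv_pow]
    push_cast
    rw [pow_sub₀ _ two_ne_zero (by omega), pow_succ]
    ring
  push_cast
  rw [h3, mul_pow, mul_pow, ← pow_mul, ← pow_mul, ← pow_mul, ← inv_pow, ← pow_mul,
    mul_comm n d, mul_comm k d]

lemma sum_pow_closeScales_le (n : ℕ) {s : ℝ} (hs : 1 ≤ s) (hs2 : s < 2 ^ d) :
    ∑ x : Fin d → Fin (2 ^ n), ∑ y : Fin d → Fin (2 ^ n),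
      s ^ (closeScales n (unitGrid n x) (unitGrid n y)).card ≤
      (1 + s * 4 ^ d * (1 - s / 2 ^ d)⁻¹) * (((2 : ℝ) ^ d) ^ n) ^ 2 := by
  classical
  have h2d : (0 : ℝ) < 2 ^ d := by positivity
  have hs0 : 0 < s := zero_lt_one.trans_le hs
  set N : ℝ := ((2 : ℝ) ^ d) ^ n with hN
  have hN0 : 0 ≤ N := by positivity
  have hcardN : (Fintype.card (Fin d → Fin (2 ^ n)) : ℝ) = N := by
    simp [hN, ← pow_mul, mul_comm]
  have hrow : ∀ x : Fin d → Fin (2 ^ n), ∑ y : Fin d → Fin (2 ^ n),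
      s ^ (closeScales n (unitGrid n x) (unitGrid n y)).card ≤
      N * (1 + s * 4 ^ d * (1 - s / 2 ^ d)⁻¹) := by
    intro x
    calc ∑ y : Fin d → Fin (2 ^ n), s ^ (closeScales n (unitGrid n x) (unitGrid n y)).card
        ≤ ∑ y : Fin d → Fin (2 ^ n),
          (1 + ∑ k ∈ closeScales n (unitGrid n x) (unitGrid n y), s ^ (k + 1)) :=
          Finset.sum_le_sum fun y _ => pow_card_le_one_add_sum hs _
      _ = N + ∑ k ∈ Finset.range n, s ^ (k + 1) *
          (({y | dist (unitGrid n x) (unitGrid n y) < 2 * (2⁻¹ : ℝ) ^ k} :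
            Finset (Fin d → Fin (2 ^ n))).card : ℝ) := by
          rw [Finset.sum_add_distrib]
          congr 1
          · simp [← hcardN]
          · simp only [closeScales, Finset.sum_filter]
            rw [Finset.sum_comm]
            refine Finset.sum_congr rfl fun k _ => ?_
            rw [← Finset.sum_filter, Finset.sum_const, nsmul_eq_mul, mul_comm]
      _ ≤ N + ∑ k ∈ Finset.range n, N * (s * 4 ^ d) * (s / 2 ^ d) ^ k := by
          refine add_le_add_right (Finset.sum_le_sum fun k hk => ?_) N
          refine (mul_le_mul_of_nonneg_left (card_close_le n k (Finset.mem_range.1 hk).le x)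
            (by positivity)).trans (le_of_eq ?_)
          rw [div_eq_mul_inv, mul_pow, pow_succ, hN]
          ring
      _ ≤ N + N * (s * 4 ^ d) * (1 - s / 2 ^ d)⁻¹ := by
          rw [← Finset.mul_sum]
          refine add_le_add_right (mul_le_mul_of_nonneg_left ?_ (by positivity)) N
          rw [← tsum_geometric_of_lt_one (by positivity) ((div_lt_one h2d).2 hs2)]
          exact (summable_geometric_of_lt_one (by positivity)
            ((div_lt_one h2d).2 hs2)).sum_le_tsum _ fun i _ => by positivity
      _ = _ := by ring
  calc _ ≤ ∑ _x : Fin d → Fin (2 ^ n), N * (1 + s * 4 ^ d * (1 - s / 2 ^ d)⁻¹) :=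
        Finset.sum_le_sum fun x _ => hrow x
    _ = _ := by
        rw [Finset.sum_const, nsmul_eq_mul, Finset.card_univ, hcardN]
        ring

/-! ### Vacancy below the critical intensity -/

/-- The shapes of the first `n` bands that come `2^{-k} r`-close to `x`, where `k` is the index of
the band. -/
def nearShapes (r : ℝ) (n : ℕ) (x : E d) : Set (Shape d) :=
  ⋃ k ∈ Finset.range n, hitBand k x ((2⁻¹ : ℝ) ^ k * r)

lemma mem_nearShapes {r : ℝ} {n : ℕ} {x : E d} {G : Shape d} :
    G ∈ nearShapes r n x ↔ ∃ k < n, G ∈ hitBand k x ((2⁻¹ : ℝ) ^ k * r) := by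
  simp [nearShapes]

/-- Since a shape of band `k` has diameter less than `2 ^ (-k)`, it is near two points only if their
distance is less than `(1 + 2 * r) * 2 ^ (-k)`. -/
lemma nearShapes_inter_subset {r : ℝ} (hr : r ≤ 1 / 2) (n : ℕ) (x y : E d) :
    nearShapes r n x ∩ nearShapes r n y ⊆
      ⋃ k ∈ closeScales n x y, hitBand k x ((2⁻¹ : ℝ) ^ k * r) := by
  rintro G ⟨hx, hy⟩
  obtain ⟨k, hk, hGx⟩ := mem_nearShapes.1 hx
  obtain ⟨j, hj, hGy⟩ := mem_nearShapes.1 hy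
  have hjk : k = j := by
    by_contra hne
    exact Set.disjoint_left.1 (pairwise_disjoint_band hne) hGx.2 hGy.2
  subst hjk
  refine Set.mem_biUnion ?_ hGx
  obtain ⟨⟨u, hu, hux⟩, -, hdiam⟩ := hGx
  obtain ⟨⟨v, hv, hvy⟩, -⟩ := hGy
  have huv : dist u v < (2⁻¹ : ℝ) ^ k := by
    have h1 := (Metric.edist_le_ediam_of_mem hu hv).trans_lt hdiam
    rw [edist_dist, ENNReal.ofReal_lt_iff_lt_toReal dist_nonneg
      (ENNReal.pow_ne_top (by simp))] at h1
    simpa using h1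
  rw [Metric.mem_ball] at hux hvy
  have hpos : (0 : ℝ) < (2⁻¹ : ℝ) ^ k := by positivity
  refine Finset.mem_filter.2 ⟨Finset.mem_range.2 hk, ?_⟩
  rw [dist_comm] at hux
  have h2 := dist_triangle4 x u v y
  nlinarith

/-- The points of the closed ball of radius `√d`, which contains the unit cube, that stay at distance
at least `2^{-k} r` from all shapes of band `k` of the process, for all `k < n`. -/
def farPoints {Ω : Type*} [MeasurableSpace Ω] [MeasurableSpace (Shape d)]
    (Φ : PointProcess Ω (Shape d)) (r : ℝ) (ω : Ω) (n : ℕ) : Set (E d) :=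
  Metric.closedBall 0 (√d) ∩ {x | ω ∈ Φ.avoid (nearShapes r n x)}

section FarPoints

variable {Ω : Type*} [MeasurableSpace Ω] [MeasurableSpace (Shape d)]
  (Φ : PointProcess Ω (Shape d)) (r : ℝ) (ω : Ω)

lemma isCompact_farPoints (n : ℕ) : IsCompact (farPoints Φ r ω n) := by
  refine (isCompact_closedBall _ _).inter_right ?_
  have key : {x : E d | ω ∈ Φ.avoid (nearShapes r n x)}ᶜ =
      ⋃ G ∈ Φ.points ω, ⋃ k ∈ {k | k < n ∧ G ∈ band d k}, ⋃ y ∈ G.carrier,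
        Metric.ball y ((2⁻¹ : ℝ) ^ k * r) := by
    ext x
    simp only [PointProcess.avoid, Set.mem_compl_iff, Set.mem_ofPred_eq, Set.mem_iUnion,
      exists_prop, not_forall, not_not, mem_nearShapes]
    refine exists_congr fun G => and_congr_right fun _ => exists_congr fun k => ?_
    constructor
    · rintro ⟨hk, ⟨y, hy, hyx⟩, hb⟩
      exact ⟨⟨hk, hb⟩, y, hy, Metric.mem_ball_comm.1 hyx⟩
    · rintro ⟨⟨hk, hb⟩, y, hy, hyx⟩
      exact ⟨hk, ⟨y, hy, Metric.mem_ball_comm.1 hyx⟩, hb⟩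
  rw [← isOpen_compl_iff, key]
  exact isOpen_biUnion fun G _ => isOpen_biUnion fun k _ => isOpen_biUnion fun y _ =>
    Metric.isOpen_ball

lemma antitone_farPoints : Antitone (farPoints Φ r ω) := by
  intro m n hmn x hx
  refine ⟨hx.1, fun G hG hGm => hx.2 G hG ?_⟩
  obtain ⟨k, hk, h⟩ := mem_nearShapes.1 hGm
  exact mem_nearShapes.2 ⟨k, hk.trans_le hmn, h⟩

/-- Only the shapes of diameter zero can cover a point that is far from all shapes in the dyadic
bands, and these cover countably many points. -/
lemma countable_iInter_farPoints (hr : 0 < r) (hω : vacantSet Φ ω = ∅) :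
    (⋂ n, farPoints Φ r ω n).Countable := by
  refine Set.Countable.mono (s₂ := ⋃ i : ℕ, {x | x ∈ (Φ.point i ω).carrier ∧
    (Φ.point i ω).carrier.Subsingleton}) ?_ (Set.countable_iUnion fun i => ?_)
  · intro x hx
    have hxv : x ∉ vacantSet Φ ω := by simp [hω]
    obtain ⟨G, hG, hxG⟩ := Set.mem_iUnion₂.1 (not_not.1 hxv)
    obtain ⟨i, hi, rfl⟩ := id hG
    refine Set.mem_iUnion.2 ⟨i, hxG, ?_⟩
    by_contra hcon
    obtain ⟨k, hk⟩ := exists_mem_band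
      (Metric.ediam_pos_iff.2 (Set.not_subsingleton_iff.1 hcon))
    refine (Set.mem_iInter.1 hx (k + 1)).2 _ hG (mem_nearShapes.2 ⟨k, by omega, ⟨x, hxG, ?_⟩, hk⟩)
    exact Metric.mem_ball_self (by positivity)
  · refine Set.Subsingleton.countable fun x hx y hy => ?_
    exact hx.2 hx.1 hy.1

end FarPoints

section Vacancy

variable [MeasurableSpace (Shape d)] {μ : Measure (Shape d)}

lemma IsSuitable.measurableSet_nearShapes (hF : IsSuitable d) (r : ℝ) (n : ℕ) (x : E d) :
    MeasurableSet (nearShapes r n x) :=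
  Finset.measurableSet_biUnion _ fun k _ => hF.measurableSet_hitBand k x _

lemma measure_nearShapes (hF : IsSuitable d) (htrans : TranslationInvariant μ)
    (hscale : SemiScaleInvariant μ) (hfin : LocallyFinite μ) (r : ℝ) (n : ℕ) (x : E d) :
    μ (nearShapes r n x) = n * μ (hitBand 0 (0 : E d) r) :=
  measure_biUnion_of_subset_band (fun k => hF.measurableSet_hitBand k x _)
    (fun _ => Set.inter_subset_right)
    (fun k => measure_hitBand hF htrans hscale hfin k x r) n

lemma measure_nearShapes_inter_le (hF : IsSuitable d) (htrans : TranslationInvariant μ)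
    (hscale : SemiScaleInvariant μ) (hfin : LocallyFinite μ) {r : ℝ} (hr : r ≤ 1 / 2) (n : ℕ)
    (x y : E d) :
    μ (nearShapes r n x ∩ nearShapes r n y) ≤
      (closeScales n x y).card * μ (hitBand 0 (0 : E d) r) := by
  refine (measure_mono (nearShapes_inter_subset hr n x y)).trans
    ((measure_biUnion_finset_le _ _).trans (le_of_eq ?_))
  simp only [measure_hitBand hF htrans hscale hfin, Finset.sum_const, nsmul_eq_mul]

/-- The second moment method, in a form that yields an uncountable set of points far from all
shapes of positive diameter. The intensity measure restricted to the shapes of diameter zero is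
arbitrary, so these shapes are only known to cover countably many points. -/
lemma not_ae_vacantSet_eq_empty (hF : IsSuitable d) (htrans : TranslationInvariant μ)
    (hscale : SemiScaleInvariant μ) (hfin : LocallyFinite μ)
    {Ω : Type*} [MeasurableSpace Ω] {P : Measure Ω} [IsProbabilityMeasure P]
    {Φ : PointProcess Ω (Shape d)} {l : ℝ≥0} (hΦ : Φ.IsPoisson ((l : ℝ≥0∞) • μ) P) {r : ℝ}
    (hr0 : 0 < r) (hr : r ≤ 1 / 2)
    (hl : l * (μ (hitBand 0 (0 : E d) r)).toReal < d * Real.log 2) :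
    ¬ ∀ᵐ ω ∂P, vacantSet Φ ω = ∅ := by
  set a := μ (hitBand 0 (0 : E d) r) with ha
  have hatop : a ≠ ∞ := (hfin.measure_hitBand_lt_top 0 0 r).ne
  set q : ℝ := Real.exp (l * a.toReal) with hq
  have hq1 : 1 ≤ q := Real.one_le_exp (by positivity)
  have hq0 : 0 < q := Real.exp_pos _
  have hq2 : q < 2 ^ d := by
    have : (2 : ℝ) ^ d = Real.exp (d * Real.log 2) := by
      rw [mul_comm, Real.exp_mul, Real.exp_log two_pos, Real.rpow_natCast]
    rw [this, hq]
    exact Real.exp_lt_exp.2 hl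
  -- The energy kernel may grow at any rate `τ ^ 2 > 1` with `τ ^ 2 * q < 2 ^ d`.
  obtain ⟨τ, hτ1, hτq⟩ : ∃ τ : ℝ, 1 < τ ∧ τ ^ 2 * q < 2 ^ d := by
    have hcont : Tendsto (fun τ : ℝ => τ ^ 2 * q) (𝓝[>] 1) (𝓝 (1 ^ 2 * q)) :=
      ((continuous_id.pow 2).mul continuous_const).continuousAt.tendsto.mono_left
        nhdsWithin_le_nhds
    have hev := hcont.eventually (gt_mem_nhds (by simpa using hq2))
    obtain ⟨τ, h1, h2⟩ := (hev.and self_mem_nhdsWithin).exists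
    exact ⟨τ, h2, h1⟩
  set s : ℝ := τ ^ 2 * q with hs
  have hτ2 : 1 ≤ τ ^ 2 := one_le_pow₀ hτ1.le
  have hs1 : 1 ≤ s := one_le_mul_of_one_le_of_one_le hτ2 hq1
  set C : ℝ := 1 + s * 4 ^ d * (1 - s / 2 ^ d)⁻¹ with hC
  have hC0 : 0 < C := by
    have : 0 < 1 - s / 2 ^ d := sub_pos.2 ((div_lt_one (by positivity)).2 hτq)
    have : 0 < s := zero_lt_one.trans_le hs1
    positivity
  set A : ∀ n, (Fin d → Fin (2 ^ n)) → Set Ω := fun n z =>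
    Φ.avoid (nearShapes r n (unitGrid n z)) with hA
  set T : ℕ → ℝ := fun n => ((2 : ℝ) ^ d) ^ n * (q ^ n)⁻¹ with hT
  have hT0 : ∀ n, 0 < T n := fun n => by positivity
  have hAm : ∀ n z, MeasurableSet (A n z) := fun n z =>
    Φ.measurableSet_avoid (hF.measurableSet_nearShapes r n _)
  have hAP : ∀ n z, P.real (A n z) = (q ^ n)⁻¹ := by
    intro n z
    have hval : ((l : ℝ≥0∞) • μ) (nearShapes r n (unitGrid n z)) = l * (n * a) := by
      rw [Measure.smul_apply, measure_nearShapes hF htrans hscale hfin, smul_eq_mul]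
    rw [measureReal_def, hΦ.measure_avoid (hF.measurableSet_nearShapes r n _)
      (by rw [hval]; finiteness), hval, ENNReal.toReal_ofReal (Real.exp_pos _).le, hq,
      ← Real.exp_nat_mul, ← Real.exp_neg]
    congr 2
    simp
    ring
  have hAAP : ∀ n x y, P.real (A n x ∩ A n y) ≤
      ((q ^ n)⁻¹) ^ 2 * q ^ (closeScales n (unitGrid n x) (unitGrid n y)).card := by
    intro n x y
    set D := nearShapes r n (unitGrid n x)
    set D' := nearShapes r n (unitGrid n y)
    set c := (closeScales n (unitGrid n x) (unitGrid n y)).card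
    have hDm : MeasurableSet D := hF.measurableSet_nearShapes r n _
    have hDm' : MeasurableSet D' := hF.measurableSet_nearShapes r n _
    have hD : μ D = n * a := measure_nearShapes hF htrans hscale hfin r n _
    have hD' : μ D' = n * a := measure_nearShapes hF htrans hscale hfin r n _
    have hna : (n : ℝ≥0∞) * a ≠ ∞ := by finiteness
    have hinter : μ (D ∩ D') ≤ c * a :=
      measure_nearShapes_inter_le hF htrans hscale hfin hr n _ _
    have hca : (c : ℝ≥0∞) * a ≠ ∞ := by finiteness
    have hunion : μ (D ∪ D') ≠ ∞ :=
      ((measure_union_le _ _).trans_lt (by rw [hD, hD']; finiteness)).ne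
    have hadd : (μ (D ∪ D')).toReal + (μ (D ∩ D')).toReal = n * a.toReal + n * a.toReal := by
      rw [← ENNReal.toReal_add hunion (ne_top_of_le_ne_top hca hinter),
        measure_union_add_inter D hDm', hD, hD', ENNReal.toReal_add hna hna]
      simp
    have hinter' : (μ (D ∩ D')).toReal ≤ c * a.toReal := by
      simpa using ENNReal.toReal_mono hca hinter
    have hlD : ((l : ℝ≥0∞) • μ) (D ∪ D') ≠ ∞ := by
      rw [Measure.smul_apply, smul_eq_mul]; finiteness
    have hcap : A n x ∩ A n y = Φ.avoid (D ∪ D') := (Φ.avoid_union D D').symm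
    rw [hcap, measureReal_def, hΦ.measure_avoid (hDm.union hDm') hlD,
      ENNReal.toReal_ofReal (Real.exp_pos _).le, hq, ← Real.exp_nat_mul, ← Real.exp_nat_mul,
      ← Real.exp_neg, ← Real.exp_nat_mul, ← Real.exp_add, Measure.smul_apply, smul_eq_mul,
      ENNReal.toReal_mul, ENNReal.coe_toReal]
    refine Real.exp_le_exp.2 ?_
    have hl0 : (0 : ℝ) ≤ l := l.2
    have : (μ (D ∪ D')).toReal ≥ 2 * n * a.toReal - c * a.toReal := by linarith
    push_cast
    nlinarith [mul_le_mul_of_nonneg_left this hl0]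
  set w : ∀ n, (Fin d → Fin (2 ^ n)) → (Fin d → Fin (2 ^ n)) → ℝ := fun n x y =>
    (τ ^ 2) ^ (closeScales n (unitGrid n x) (unitGrid n y)).card with hw
  have hprob : ∀ n, 1 / (16 * C) ≤ P.real (spreadEvent (A n) (w n) (T n) (4 * C)) := by
    intro n
    refine le_measureReal_spreadEvent (hAm n) (fun x y => one_le_pow₀ hτ2) (hT0 n) hC0 ?_ ?_
    · simp only [hAP, Finset.sum_const, nsmul_eq_mul, hT]
      simp [← pow_mul, mul_comm]
    · calc ∑ x, ∑ y, w n x y * P.real (A n x ∩ A n y)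
          ≤ ∑ x, ∑ y, ((q ^ n)⁻¹) ^ 2 *
              s ^ (closeScales n (unitGrid n x) (unitGrid n y)).card := by
            refine Finset.sum_le_sum fun x _ => Finset.sum_le_sum fun y _ => ?_
            refine (mul_le_mul_of_nonneg_left (hAAP n x y) (by positivity)).trans (le_of_eq ?_)
            rw [hs, mul_pow]
            ring
        _ = ((q ^ n)⁻¹) ^ 2 * ∑ x : Fin d → Fin (2 ^ n), ∑ y : Fin d → Fin (2 ^ n),
              s ^ (closeScales n (unitGrid n x) (unitGrid n y)).card := by
            simp only [Finset.mul_sum]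
        _ ≤ ((q ^ n)⁻¹) ^ 2 * (C * (((2 : ℝ) ^ d) ^ n) ^ 2) :=
            mul_le_mul_of_nonneg_left (sum_pow_closeScales_le n hs1 hτq) (by positivity)
        _ = C * T n ^ 2 := by rw [hT]; ring
  have hpos := measure_frequently_pos
    (fun n => measurableSet_spreadEvent (hAm n) (w n) (T n) (4 * C)) (by positivity) hprob
  intro hae
  refine hpos.ne' (measure_mono_null (fun ω hω => ?_) (ae_iff.1 hae))
  intro hvac
  refine not_countable_iInter (isCompact_farPoints Φ r ω) (antitone_farPoints Φ r ω)
    (fun n => unitGrid n) (fun n => occurring (A n) ω) (fun n z hz => ?_) hT0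
    (by positivity : 0 < 4 * C) hτ1 hω (countable_iInter_farPoints Φ r ω hr0 hvac)
  have hz' : ω ∈ A n z := mem_occurring.1 hz
  exact ⟨dist_unitGrid_zero_le n z, hz'⟩

end Vacancy

end PoissonFractal

theorem theorem1p1 {d : ℕ} (hd : 1 ≤ d) [MeasurableSpace (PoissonFractal.Shape d)]
    (hF : PoissonFractal.IsSuitable d)
    (μ : Measure (PoissonFractal.Shape d))
    (htrans : PoissonFractal.TranslationInvariant μ)
    (hscale : PoissonFractal.SemiScaleInvariant μ)
    (hfin : PoissonFractal.LocallyFinite μ)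
    (hbdry : PoissonFractal.NullBoundaries μ)
    (hpos : PoissonFractal.PositiveVolumes μ)
    {Ω : ℝ≥0 → Type*} [∀ l, MeasurableSpace (Ω l)]
    (P : ∀ l, Measure (Ω l)) [∀ l, IsProbabilityMeasure (P l)]
    (Φ : ∀ l, PoissonFractal.PointProcess (Ω l) (PoissonFractal.Shape d))
    (hΦ : ∀ l, 0 < l → (Φ l).IsPoisson ((l : ℝ≥0∞) • μ) (P l)) :
    0 < μ (PoissonFractal.A₁ d) ∧ μ (PoissonFractal.A₁ d) < ∞ ∧
      PoissonFractal.criticalIntensity P Φ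
        = ENNReal.ofReal (d * Real.log 2) / μ (PoissonFractal.A₁ d) := by
  have hA0 := PoissonFractal.measure_A₁_pos hd hF htrans hscale hfin hbdry hpos
  have hAtop := PoissonFractal.measure_A₁_lt_top hfin
  refine ⟨hA0, hAtop, le_antisymm ?_ ?_⟩
  · refine le_of_forall_gt fun t ht => ?_
    obtain ⟨l, hl1, hl2⟩ := ENNReal.lt_iff_exists_nnreal_btwn.1 ht
    have hl0 : 0 < l := ENNReal.coe_pos.1 (bot_le.trans_lt hl1)
    have hl0' : (l : ℝ≥0∞) ≠ 0 := by exact_mod_cast hl0.ne'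
    have hlt : ENNReal.ofReal (d * Real.log 2) / l < μ (PoissonFractal.A₁ d) := by
      rw [ENNReal.div_lt_iff (Or.inl hA0.ne') (Or.inl hAtop.ne)] at hl1
      rwa [ENNReal.div_lt_iff (Or.inl hl0') (Or.inl ENNReal.coe_ne_top), mul_comm (μ _)]
    obtain ⟨m, hm⟩ :=
      PoissonFractal.exists_lt_measure_containBand hF htrans hfin hbdry hlt
    have hle : PoissonFractal.criticalIntensity P Φ ≤ l := by
      refine iInf₂_le l ⟨hl0, ?_⟩
      refine PoissonFractal.ae_vacantSet_eq_empty hF htrans hscale hfin (hΦ l hl0) (m := m) ?_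
      rw [ENNReal.div_lt_iff (Or.inl hl0') (Or.inl ENNReal.coe_ne_top), mul_comm (μ _)] at hm
      have hcont : μ (PoissonFractal.containBand 0 (0 : PoissonFractal.E d) ((2⁻¹ : ℝ) ^ m)) ≠ ∞ :=
        ((measure_mono (PoissonFractal.containBand_subset_hitBand (by positivity))).trans_lt
          (hfin.measure_hitBand_lt_top 0 0 _)).ne
      rw [ENNReal.ofReal_lt_iff_lt_toReal (by positivity) (by finiteness)] at hm
      simpa using hm
    exact hle.trans_lt hl2
  · refine le_iInf₂ fun l hl => ?_
    obtain ⟨hl0, hvac⟩ := hl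
    by_contra! hcon
    have hl0' : (l : ℝ≥0∞) ≠ 0 := by exact_mod_cast hl0.ne'
    have hlt : μ (PoissonFractal.A₁ d) < ENNReal.ofReal (d * Real.log 2) / l := by
      rw [ENNReal.lt_div_iff_mul_lt (Or.inl hA0.ne') (Or.inl hAtop.ne)] at hcon
      rwa [ENNReal.lt_div_iff_mul_lt (Or.inl hl0') (Or.inl ENNReal.coe_ne_top), mul_comm]
    obtain ⟨r, hr0, hr, hrlt⟩ :=
      PoissonFractal.exists_measure_hitBand_lt hF htrans hfin hbdry hlt
    refine PoissonFractal.not_ae_vacantSet_eq_empty hF htrans hscale hfin (hΦ l hl0) hr0 hr ?_ hvac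
    rw [ENNReal.lt_div_iff_mul_lt (Or.inl hl0') (Or.inl ENNReal.coe_ne_top), mul_comm,
      ENNReal.lt_ofReal_iff_toReal_lt] at hrlt
    · simpa using hrlt
    · have := (hfin.measure_hitBand_lt_top 0 (0 : PoissonFractal.E d) r).ne
      finiteness
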